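/- Let $N$ and $m$ be positive integers and $k$ a positive even integer. Let $\mathbb H$ be the upper half-plane, and for $\gamma=\begin{pmatrix}a&b\\c&d\end{pmatrix}\in SL_2(\mathbb R)$ and $f\colon\mathbb H\to\mathbb C$ put $(f|_k\gamma)(z)=(cz+d)^{-k}f(\gamma z)$. Let $f$ be a weakly holomorphic cusp form of weight $k$ for $\Gamma_0(N)$, i.e. $f$ is holomorphic on $\mathbb H$, $f|_k\gamma=f$ for all $\gamma\in\Gamma_0(N)$, and for every $\gamma\in SL_2(\mathbb Z)$ the function $f|_k\gamma$ has an expansion in powers of $e^{2\pi i z/N}$ with only finitely many negative exponents and with constant term $0$. Write $f(z)=\sum_{n\ge -n_0,\,n\ne0}a_f(n)e^{2\pi i n z}$, and suppose that $f|_kW_N=f$, where $W_N=\begin{pmatrix}0&-1/\sqrt N\\\sqrt N&0\end{pmatrix}$. All powers and logarithms are principal, with $-\pi<\arg z\le\pi$. For $p\in\mathbb C$ and $z\neq 0$ let $E_p(z)$ be the principal branch of the generalised exponential integral, that is, the analytic continuation in $z$ of $\int_1^\infty e^{-zt}t^{-p}\,dt$ ($\operatorname{Re}z>0$) to $\mathbb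 C\setminus(-\infty,0]$, extended to $z<0$ by continuity from above; explicitly, $$E_p(z)=z^{p-1}\Gamma(1-p)-\sum_{r\ge0}\frac{(-z)^r}{r!\,(1-p+r)}\qquad(p\notin\{1,2,3,\dots\}),$$ $$E_p(z)=\frac{(-z)^{p-1}}{(p-1)!}\left(\psi(p)-\log z\right)-\sum_{r\ge0,\;r\ne p-1}\frac{(-z)^r}{r!\,(1-p+r)}\qquad(p\in\{1,2,3,\dots\}),$$ where $\psi=\Gamma'/\Gamma$. Put $$\Lambda(f,s)=\sum_{n\ge -n_0,\;n\neq0}a_f(n)\,E_{1-s}\!\left(\frac{2\pi n}{\sqrt N}\right).$$ For $z\in\mathbb H$ let $\zeta(s,z)$ be the Hurwitz zeta function, i.e. the analytic continuation to $s\in\mathbb C\setminus\{1\}$ of $\sum_{n\ge0}(z+n)^{-s}$ ($\operatorname{Re}s>1$), and let $\zeta^{(r)}(s,z)=\frac{\partial^r}{\partial s^r}\zeta(s,z)$. Then for $\operatorname{Re}s>0$ the series $\Lambda(f,s)$ converges absolutely and is holomorphic in $s$, for every $r\ge0$ the function $f(z)\,\zeta^{(r)}(1-\frac k2,z)$ is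 integrable along the segment from $\frac{i}{\sqrt N}$ to $\frac{i}{\sqrt N}+1$, and the $m$-th derivative of $\Lambda(f,s)$ with respect to $s$ at $s=k/2$ is $$\Lambda^{(m)}\!\left(f,\tfrac k2\right)=i^{2m-\frac k2}N^{\frac k4}\sum_{j=0}^m\binom mj\log^j\!\left(\frac{i}{\sqrt N}\right)\int_{\frac{i}{\sqrt N}}^{\frac{i}{\sqrt N}+1}f(z)\,\zeta^{(m-j)}\!\left(1-\tfrac k2,z\right)dz,$$ the integral being taken along the straight segment. -/

import Mathlib

open scoped UpperHalfPlane ModularForm MatrixGroups Manifold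

namespace WeaklyHolomorphic

noncomputable section

/-- The Fricke matrix `W_N = (0, -1/√N; √N, 0)` in `SL(2, ℝ)`. -/
def frickeMatrix (N : ℕ) (hN : 0 < N) : SL(2, ℝ) :=
  ⟨!![0, -1 / Real.sqrt N; Real.sqrt N, 0], by
    have h : Real.sqrt N ≠ 0 := (Real.sqrt_pos.mpr (by exact_mod_cast hN)).ne'
    rw [Matrix.det_fin_two_of]
    field_simp
    norm_num⟩

/-- `g` has an expansion `g(z) = ∑_{n ≥ -n₀} a(n) e^{2πinz/h}` on the upper half-plane, with only
finitely many terms of negative index and with vanishing constant term. -/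
def HasCuspidalExpansion (h : ℕ) (g : ℍ → ℂ) : Prop :=
  ∃ (n₀ : ℕ) (a : ℤ → ℂ), (∀ n : ℤ, n < -(n₀ : ℤ) → a n = 0) ∧ a 0 = 0 ∧
    ∀ z : ℍ, HasSum
      (fun n : ℤ => a n * Complex.exp (2 * Real.pi * Complex.I * n * (z : ℂ) / h)) (g z)

/-- Weakly holomorphic cusp forms of weight `k` for `Γ₀(N)`: holomorphic on the upper half-plane,
invariant under the weight `k` action of `Γ₀(N)`, meromorphic at every cusp, and with vanishing
constant term at every cusp. The cusp `γ∞` is treated through `f ∣[k] γ`, for which `N` is always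
a period, as the principal congruence subgroup `Γ(N)` is normal and contained in `Γ₀(N)`. -/
structure IsWeaklyHolomorphicCuspForm (N : ℕ) (k : ℤ) (f : ℍ → ℂ) : Prop where
  holo : MDifferentiable 𝓘(ℂ) 𝓘(ℂ) f
  slash_eq : ∀ γ ∈ CongruenceSubgroup.Gamma0 N, f ∣[k] γ = f
  expansion : ∀ γ : SL(2, ℤ), HasCuspidalExpansion N (f ∣[k] γ)

/-- The `n`-th Fourier coefficient `a_f(n) = ∫_0^1 f(x + i) e^{-2πin(x + i)} dx` at the cusp `∞`
of a holomorphic function `f` of period `1` on the upper half-plane. -/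
def coeff (f : ℍ → ℂ) (n : ℤ) : ℂ :=
  ∫ x in (0 : ℝ)..1, f (UpperHalfPlane.ofComplex (x + Complex.I)) *
    Complex.exp (-(2 * Real.pi * Complex.I * n * (x + Complex.I)))

open Classical in
/-- The principal branch of the generalised exponential integral `E_p(z)`, `z ≠ 0`: the analytic
continuation of `∫_1^∞ e^{-zt} t^{-p} dt` from `Re z > 0` to `ℂ ∖ (-∞, 0]`, extended to the
negative real axis by `arg z = π` (continuity from above). The two cases are `p ∈ {1, 2, 3, …}`,
where `Γ(p) = (p-1)!`, and all other `p`. -/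
def expIntegral (p z : ℂ) : ℂ :=
  if ∃ n : ℕ, p = (n : ℂ) + 1 then
    (-z) ^ (p - 1) / Complex.Gamma p * (Complex.digamma p - Complex.log z) -
      ∑' r : {r : ℕ // (r : ℂ) ≠ p - 1},
        (-z) ^ (r : ℕ) / ((Nat.factorial (r : ℕ) : ℂ) * (1 - p + ((r : ℕ) : ℂ)))
  else
    z ^ (p - 1) * Complex.Gamma (1 - p) -
      ∑' r : ℕ, (-z) ^ r / ((Nat.factorial r : ℂ) * (1 - p + (r : ℂ)))

/-- The `n`-th term of the series `Λ(f, s)`. -/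
def lambdaTerm (N : ℕ) (f : ℍ → ℂ) (s : ℂ) (n : ℤ) : ℂ :=
  coeff f n * expIntegral (1 - s) (2 * Real.pi * n / Real.sqrt N)

/-- `Λ(f, s) = ∑_{n ≠ 0} a_f(n) E_{1-s}(2πn/√N)`. -/
def Lambda (N : ℕ) (f : ℍ → ℂ) (s : ℂ) : ℂ :=
  ∑' n : {n : ℤ // n ≠ 0}, lambdaTerm N f s n

/-- `g` is holomorphic on `ℂ ∖ {1}` and equals `∑_{n ≥ 0} (z + n)^{-s}` for `Re s > 1`. By the
identity theorem at most one function on `ℂ ∖ {1}` has this property. -/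
def IsHurwitzZeta (z : ℂ) (g : ℂ → ℂ) : Prop :=
  DifferentiableOn ℂ g {1}ᶜ ∧
    ∀ s : ℂ, 1 < s.re → HasSum (fun n : ℕ => (z + n) ^ (-s)) (g s)

open Classical in
/-- The Hurwitz zeta function `ζ(s, z)`, for `z` in the upper half-plane and `s ≠ 1`: the analytic
continuation in `s` of `∑_{n ≥ 0} (z + n)^{-s}`. -/
def hurwitz (s z : ℂ) : ℂ :=
  if h : ∃ g : ℂ → ℂ, IsHurwitzZeta z g then h.choose s else 0

/-- `ζ^{(r)}(s, z)`, the `r`-th derivative with respect to `s`. -/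
def hurwitzDeriv (r : ℕ) (s z : ℂ) : ℂ :=
  iteratedDeriv r (fun t : ℂ => hurwitz t z) s

/-- The integrand `f(z) ζ^{(r)}(1 - k/2, z)` at the point `z = i/√N + x` of the segment from
`i/√N` to `i/√N + 1`. -/
def segmentIntegrand (N k : ℕ) (f : ℍ → ℂ) (r : ℕ) (x : ℝ) : ℂ :=
  f (UpperHalfPlane.ofComplex (Complex.I / Real.sqrt N + x)) *
    hurwitzDeriv r (1 - (k : ℂ) / 2) (Complex.I / Real.sqrt N + x)

end

end WeaklyHolomorphic

open scoped UpperHalfPlane ModularForm MatrixGroups Manifold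
open Filter Topology Set MeasureTheory

/-! The mechanism is the difference equation `ζ(w, z) - ζ(w, z + 1) = z ^ (-w)`. For `n ≠ 0` and `Re
s > 0` put `Φ(z) = ∫_z^{z+1} e^{2πint} ζ(1 - s, t) dt`. Since the exponential has period 1, `Φ'(z) =
-e^{2πinz} z^{s-1}`, so `Φ` is an incomplete gamma function up to a constant. Polynomial growth of
`ζ` against exponential decay makes `Φ` vanish towards `i∞` for `n > 0` and towards `-i∞` for `n <
0`; Euler's integral then gives the constant, and at `z = i/√N` the outcome is `Φ(z) = z^s
E_{1-s}(2πn/√N)` (`hurwitzFourier_eq_expIntegral`). The case `n < 0` is why `ζ` is studied on the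
whole slit plane and not only on the upper half-plane.

Integrating the Fourier expansion of `f` term by term against `ζ(1 - s, z)` along the segment yields
`Λ(f, s) = (i/√N)^{-s} ∫ f(z) ζ(1 - s, z) dz` for `Re s > 0` (`hasSum_lambdaTerm`). The theorem
follows by differentiating under the integral sign and applying Leibniz' rule to this product.

The continuation of `ζ(s, z)`, with joint continuity, holomorphy in each variable and polynomial
growth, rests on `(s - 1) ζ(s, z) = z^{1-s} + (s - 1) ∫_0^1 (1 - x) s ζ(s + 1, z + x) dx`. Its right
side needs the function only at `s + 1`, so iteration reaches every `s`; `IsHurwitzFamily` collects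
the properties that each iteration preserves. -/

namespace WeaklyHolomorphic

/-! ### Integrals depending holomorphically on a parameter -/

section Parametric

variable {X : Type*} [TopologicalSpace X]

theorem tendstoLocallyUniformlyOn_of_continuousOn_prod {F : ℂ → X → ℂ} {U : Set ℂ} {K : Set X}
    (hF : ContinuousOn (Function.uncurry F) (U ×ˢ K)) {x₀ : X} (hx₀ : x₀ ∈ K) :
    TendstoLocallyUniformlyOn (fun x s => F s x) (fun s => F s x₀) (𝓝[K] x₀) U := by
  rw [Metric.tendstoLocallyUniformlyOn_iff]
  intro ε hε s hs
  have h := Metric.tendsto_nhds.1 (hF (s, x₀) ⟨hs, hx₀⟩) (ε / 2) (half_pos hε)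
  rw [nhdsWithin_prod_eq, eventually_prod_iff] at h
  obtain ⟨p, hp, q, hq, hpq⟩ := h
  refine ⟨{y | p y}, hp, hq.mono fun x hx y hy => ?_⟩
  have h1 := hpq hy hx
  have h2 := hpq hy (hq.self_of_nhdsWithin hx₀)
  simp only [Function.uncurry] at h1 h2
  linarith [dist_triangle_right (F y x₀) (F y x) (F s x₀)]

/-- By Weierstrass: joint continuity makes `F · x` tend to `F · x₀` locally uniformly in `s`, and
for holomorphic functions this passes to the derivatives. -/
theorem continuousOn_deriv_of_continuousOn_prod {F : ℂ → X → ℂ} {U : Set ℂ} {K : Set X}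
    (hU : IsOpen U) (hF : ContinuousOn (Function.uncurry F) (U ×ˢ K))
    (hd : ∀ x ∈ K, DifferentiableOn ℂ (fun s => F s x) U) :
    ContinuousOn (Function.uncurry fun s x => deriv (fun t => F t x) s) (U ×ˢ K) := by
  rintro ⟨s₀, x₀⟩ ⟨hs₀, hx₀⟩
  have hl := (tendstoLocallyUniformlyOn_of_continuousOn_prod hF hx₀).deriv
    (eventually_nhdsWithin_of_forall hd) hU
  have hc : ContinuousWithinAt (deriv fun t => F t x₀) U s₀ :=
    ((hd x₀ hx₀).deriv hU).continuousOn s₀ hs₀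
  rw [Metric.tendstoLocallyUniformlyOn_iff] at hl
  refine Metric.tendsto_nhds.2 fun ε hε => ?_
  obtain ⟨t, ht, hxt⟩ := hl (ε / 2) (half_pos hε) s₀ hs₀
  rw [nhdsWithin_prod_eq]
  have h3 := (inter_mem ht (Metric.tendsto_nhds.1 hc (ε / 2) (half_pos hε)))
  refine (Filter.Eventually.prod_mk (la := 𝓝[U] s₀) (lb := 𝓝[K] x₀) h3 hxt).mono ?_
  rintro ⟨s, x⟩ ⟨⟨h1, h2⟩, h4⟩
  have h5 := h4 s h1
  simp only [Function.uncurry, mem_ofPred_eq, Function.comp_apply] at h2 h5 ⊢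
  have := dist_triangle_left (deriv (fun t => F t x) s) (deriv (fun t => F t x₀) s₀)
    (deriv (fun t => F t x₀) s)
  linarith

theorem continuousOn_intervalIntegral_of_continuousOn_prod {F : X → ℝ → ℂ} {S : Set X}
    (hF : ContinuousOn (Function.uncurry F) (S ×ˢ Icc 0 1)) :
    ContinuousOn (fun p => ∫ x in (0 : ℝ)..1, F p x) S := by
  rw [continuousOn_iff_continuous_domRestrict]
  -- Clamping `x` to `[0, 1]` makes the integrand continuous on all of `S × ℝ` without changing the
  -- integral.
  have h : Continuous (Function.uncurry fun (p : S) (x : ℝ) =>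
      F p (projIcc (0 : ℝ) 1 zero_le_one x)) :=
    hF.comp_continuous (f := fun q : S × ℝ => ((q.1 : X), (projIcc (0 : ℝ) 1 zero_le_one q.2 : ℝ)))
      (by fun_prop) fun q => ⟨q.1.2, (projIcc (0 : ℝ) 1 zero_le_one q.2).2⟩
  convert intervalIntegral.continuous_parametric_intervalIntegral_of_continuous' (μ := volume)
    h 0 1 using 2 with p
  refine intervalIntegral.integral_congr fun x hx => ?_
  rw [uIcc_of_le zero_le_one] at hx
  simp only [projIcc_of_mem zero_le_one hx]

end Parametric

section Holomorphic

variable {F : ℂ → ℝ → ℂ} {U : Set ℂ}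

theorem continuousOn_right_of_continuousOn_prod
    (hF : ContinuousOn (Function.uncurry F) (U ×ˢ Icc 0 1)) {s : ℂ} (hs : s ∈ U) :
    ContinuousOn (F s) (Icc 0 1) :=
  hF.comp (f := fun x => (s, x)) (by fun_prop) fun _ hx => ⟨hs, hx⟩

theorem intervalIntegrable_of_continuousOn_prod
    (hF : ContinuousOn (Function.uncurry F) (U ×ˢ Icc 0 1)) {s : ℂ} (hs : s ∈ U) :
    IntervalIntegrable (F s) volume 0 1 :=
  (continuousOn_right_of_continuousOn_prod hF hs).intervalIntegrable_of_Icc zero_le_one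

theorem hasDerivAt_intervalIntegral_of_continuousOn_prod (hU : IsOpen U)
    (hF : ContinuousOn (Function.uncurry F) (U ×ˢ Icc 0 1))
    (hd : ∀ x ∈ Icc (0 : ℝ) 1, DifferentiableOn ℂ (fun s => F s x) U) {s : ℂ} (hs : s ∈ U) :
    HasDerivAt (fun s => ∫ x in (0 : ℝ)..1, F s x)
      (∫ x in (0 : ℝ)..1, deriv (fun t => F t x) s) s := by
  have hF' := continuousOn_deriv_of_continuousOn_prod hU hF hd
  obtain ⟨r, hr, hrU⟩ := Metric.nhds_basis_closedBall.mem_iff.1 (hU.mem_nhds hs)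
  obtain ⟨C, hC⟩ := (((isCompact_closedBall s r).prod (isCompact_Icc (a := (0 : ℝ)) (b := 1))
    ).exists_bound_of_continuousOn (hF'.mono (prod_mono_left hrU)))
  have hsub : uIoc (0 : ℝ) 1 ⊆ Icc 0 1 := by
    rw [uIoc_of_le zero_le_one]; exact Ioc_subset_Icc_self
  refine (intervalIntegral.hasDerivAt_integral_of_dominated_loc_of_deriv_le
    (F' := fun s x => deriv (fun t => F t x) s) (bound := fun _ => C)
    (Metric.closedBall_mem_nhds s hr) ?_ ?_ ?_ ?_ ?_ ?_).2
  · filter_upwards [hU.mem_nhds hs] with t ht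
    exact (intervalIntegrable_of_continuousOn_prod hF ht).def'.aestronglyMeasurable
  · exact intervalIntegrable_of_continuousOn_prod hF hs
  · exact (intervalIntegrable_of_continuousOn_prod hF' hs).def'.aestronglyMeasurable
  · exact Eventually.of_forall fun x hx t ht => hC (t, x) ⟨ht, hsub hx⟩
  · exact intervalIntegrable_const
  · exact Eventually.of_forall fun x hx t ht =>
      ((hd x (hsub hx)).differentiableAt (hU.mem_nhds (hrU ht))).hasDerivAt

theorem differentiableOn_intervalIntegral_of_continuousOn_prod (hU : IsOpen U)
    (hF : ContinuousOn (Function.uncurry F) (U ×ˢ Icc 0 1))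
    (hd : ∀ x ∈ Icc (0 : ℝ) 1, DifferentiableOn ℂ (fun s => F s x) U) :
    DifferentiableOn ℂ (fun s => ∫ x in (0 : ℝ)..1, F s x) U := fun _ hs =>
  (hasDerivAt_intervalIntegral_of_continuousOn_prod hU hF hd
    hs).differentiableAt.differentiableWithinAt

/-- The three claims go through one induction: differentiating once more under the integral needs
the joint continuity and holomorphy of the previous derivative. -/
theorem iteratedDeriv_continuousOn_prod (hU : IsOpen U)
    (hF : ContinuousOn (Function.uncurry F) (U ×ˢ Icc 0 1))
    (hd : ∀ x ∈ Icc (0 : ℝ) 1, DifferentiableOn ℂ (fun s => F s x) U) (r : ℕ) :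
    ContinuousOn (Function.uncurry fun s x => iteratedDeriv r (fun t => F t x) s)
      (U ×ˢ Icc 0 1) ∧
    (∀ x ∈ Icc (0 : ℝ) 1, DifferentiableOn ℂ (iteratedDeriv r (fun t => F t x)) U) ∧
    ∀ s ∈ U, iteratedDeriv r (fun s => ∫ x in (0 : ℝ)..1, F s x) s =
      ∫ x in (0 : ℝ)..1, iteratedDeriv r (fun t => F t x) s := by
  induction r with
  | zero => exact ⟨by simpa using hF, by simpa only [iteratedDeriv_zero] using hd, by simp⟩
  | succ r ih =>
    obtain ⟨h1, h2, h3⟩ := ih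
    simp only [iteratedDeriv_succ]
    refine ⟨continuousOn_deriv_of_continuousOn_prod hU h1 h2, fun x hx => (h2 x hx).deriv hU,
      fun s hs => ?_⟩
    rw [← (hasDerivAt_intervalIntegral_of_continuousOn_prod hU h1 h2 hs).deriv]
    exact EventuallyEq.deriv_eq (eventually_of_mem (hU.mem_nhds hs) h3)

end Holomorphic

/-! ### The Hurwitz zeta function on the slit plane -/

open Complex in
theorem norm_cpow_le_mul_exp (w p : ℂ) : ‖w ^ p‖ ≤ ‖w‖ ^ p.re * Real.exp (Real.pi * |p.im|) := by
  refine (norm_cpow_le w p).trans ?_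
  rw [div_eq_mul_inv, ← Real.exp_neg]
  gcongr
  calc -(arg w * p.im) ≤ |arg w * p.im| := neg_le_abs _
    _ ≤ _ := by rw [abs_mul]; gcongr; exact abs_arg_le_pi w

open Complex in
theorem add_ofReal_mem_slitPlane {z : ℂ} (hz : z ∈ slitPlane) {x : ℝ} (hx : 0 ≤ x) :
    z + x ∈ slitPlane := by
  rw [mem_slitPlane_iff] at hz ⊢
  rcases hz with h | h
  · left; simp; linarith
  · right; simpa using h

open Complex in
theorem add_natCast_mem_slitPlane {z : ℂ} (hz : z ∈ slitPlane) (n : ℕ) : z + n ∈ slitPlane := by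
  simpa using add_ofReal_mem_slitPlane hz n.cast_nonneg

theorem summable_natCast_add_one_rpow {σ : ℝ} (hσ : 1 < σ) :
    Summable fun n : ℕ => ((n : ℝ) + 1) ^ (-σ) := by
  have := (summable_nat_add_iff 1).2 (Real.summable_nat_rpow.2 (by linarith : -σ < -1))
  simpa using this

theorem norm_cpow_neg_le_of_le {w s : ℂ} {σ T y : ℝ} (hσ : 0 ≤ σ) (hs : σ ≤ s.re) (hT : |s.im| ≤ T)
    (hy : 1 ≤ y) (hw : y ≤ ‖w‖) : ‖w ^ (-s)‖ ≤ y ^ (-σ) * Real.exp (Real.pi * T) := by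
  refine (norm_cpow_le_mul_exp w (-s)).trans ?_
  have h1 : ‖w‖ ^ (-s).re ≤ y ^ (-σ) := by
    rw [Complex.neg_re]
    calc ‖w‖ ^ (-s.re) ≤ y ^ (-s.re) :=
          Real.rpow_le_rpow_of_nonpos (by linarith) hw (by linarith)
      _ ≤ y ^ (-σ) := Real.rpow_le_rpow_of_exponent_le hy (by linarith)
  gcongr
  simpa using hT

theorem norm_add_natCast_cpow_le {z s : ℂ} (n : ℕ) {σ T : ℝ} (hσ : 0 ≤ σ) (hs : σ ≤ s.re)
    (hT : |s.im| ≤ T) (hz : 1 ≤ z.re) :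
    ‖(z + n) ^ (-s)‖ ≤ ((n : ℝ) + 1) ^ (-σ) * Real.exp (Real.pi * T) := by
  refine norm_cpow_neg_le_of_le hσ hs hT (by linarith [n.cast_nonneg (α := ℝ)]) ?_
  refine le_trans ?_ (Complex.re_le_norm _)
  simp; linarith

theorem norm_add_natCast_cpow_le_of_one_le_im {z s : ℂ} (n : ℕ) (hs : 0 ≤ s.re)
    (hz : 0 ≤ z.re) (hz' : 1 ≤ |z.im|) :
    ‖(z + n) ^ (-s)‖ ≤
      ((n : ℝ) + 1) ^ (-s.re) * (2 ^ s.re * Real.exp (Real.pi * |s.im|)) := by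
  have h0 : (0 : ℝ) < (n : ℝ) + 1 := by positivity
  have h1 : 1 ≤ ‖z + n‖ := by
    have := Complex.abs_im_le_norm (z + n)
    simp at this; linarith
  have h2 : (n : ℝ) ≤ ‖z + n‖ := by
    refine le_trans ?_ (Complex.re_le_norm _)
    simp; linarith
  refine (norm_cpow_le_mul_exp _ _).trans ?_
  rw [← mul_assoc]
  have h3 : ‖z + n‖ ^ (-s).re ≤ (((n : ℝ) + 1) / 2) ^ (-s.re) := by
    rw [Complex.neg_re]
    exact Real.rpow_le_rpow_of_nonpos (by positivity) (by linarith) (by linarith)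
  rw [Real.div_rpow h0.le zero_le_two, Real.rpow_neg zero_le_two, div_inv_eq_mul] at h3
  have h4 : |(-s).im| = |s.im| := by simp
  rw [h4]
  gcongr

theorem summable_add_natCast_cpow {z s : ℂ} (hs : 1 < s.re) :
    Summable fun n : ℕ => (z + n) ^ (-s) := by
  obtain ⟨M, hM⟩ := exists_nat_ge (1 - z.re)
  rw [← summable_nat_add_iff M]
  refine Summable.of_norm_bounded ((summable_natCast_add_one_rpow hs).mul_right
    (Real.exp (Real.pi * |s.im|))) fun n => ?_
  have := norm_add_natCast_cpow_le (z := z + M) n (by linarith) le_rfl le_rfl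
    (by simp; linarith) (s := s)
  rwa [show z + M + n = z + ((n + M : ℕ) : ℂ) by push_cast; ring] at this

open Complex in
theorem hasDerivAt_add_ofReal_cpow {z : ℂ} (hz : z ∈ slitPlane) (p : ℂ) {x : ℝ} (hx : 0 ≤ x) :
    HasDerivAt (fun x : ℝ => (z + x) ^ p) (p * (z + x) ^ (p - 1)) x := by
  have h : HasDerivAt (fun y : ℂ => (z + y) ^ p) (p * (z + x) ^ (p - 1) * 1) (x : ℂ) :=
    ((hasDerivAt_id (x : ℂ)).const_add z).cpow_const (add_ofReal_mem_slitPlane hz hx)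
  simpa using h.comp_ofReal

open Complex in
theorem continuousOn_add_ofReal_cpow {z : ℂ} (hz : z ∈ slitPlane) (p : ℂ) :
    ContinuousOn (fun x : ℝ => (z + x) ^ p) (Icc 0 1) := fun _ hx =>
  (hasDerivAt_add_ofReal_cpow hz p hx.1).continuousAt.continuousWithinAt

open Complex in
-- Taylor's formula with integral remainder for `t ^ (1 - s)` between `z` and `z + 1`. It is the
-- termwise form of the continuation identity.
theorem integral_one_sub_mul_cpow {z : ℂ} (hz : z ∈ slitPlane) (s : ℂ) :
    (s - 1) * ∫ x in (0 : ℝ)..1, (1 - x) * (s * (z + x) ^ (-(s + 1))) =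
      (s - 1) * z ^ (-s) + (z + 1) ^ (1 - s) - z ^ (1 - s) := by
  have hu : uIcc (0 : ℝ) 1 = Icc 0 1 := uIcc_of_le zero_le_one
  rw [← intervalIntegral.integral_const_mul]
  have hd : ∀ x ∈ uIcc (0 : ℝ) 1, HasDerivAt
      (fun x : ℝ => (z + x) ^ (1 - s) - (s - 1) * ((1 - x) * (z + x) ^ (-s)))
      ((s - 1) * ((1 - x) * (s * (z + x) ^ (-(s + 1))))) x := by
    intro x hx
    rw [hu] at hx
    have h1 := hasDerivAt_add_ofReal_cpow hz (1 - s) hx.1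
    have h2 := hasDerivAt_add_ofReal_cpow hz (-s) hx.1
    have h3 : HasDerivAt (fun x : ℝ => (1 - x : ℂ)) (-1) x := by
      simpa using (hasDerivAt_id (x : ℂ)).comp_ofReal.const_sub 1
    refine (h1.sub ((h3.mul h2).const_mul (s - 1))).congr_deriv ?_
    rw [show 1 - s - 1 = -s by ring, show -s - 1 = -(s + 1) by ring]
    ring
  rw [intervalIntegral.integral_eq_sub_of_hasDerivAt hd]
  · simp; ring
  · refine ContinuousOn.intervalIntegrable ?_
    rw [hu]
    have := continuousOn_add_ofReal_cpow hz (-(s + 1))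
    fun_prop

/-- Regularity of a family of functions `H s` on the slit plane, for `c < Re s`, in the way of
`H s z = (s - 1) ζ(s, z)`. -/
structure IsHurwitzFamily (c : ℝ) (H : ℂ → ℂ → ℂ) : Prop where
  continuousOn : ContinuousOn (Function.uncurry H) ({s : ℂ | c < s.re} ×ˢ Complex.slitPlane)
  differentiableOn_left : ∀ z ∈ Complex.slitPlane,
    DifferentiableOn ℂ (fun s => H s z) {s : ℂ | c < s.re}
  differentiableOn_right : ∀ s : ℂ, c < s.re → DifferentiableOn ℂ (H s) Complex.slitPlane
  sub_shift : ∀ s : ℂ, c < s.re → ∀ z ∈ Complex.slitPlane,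
    H s z - H s (z + 1) = (s - 1) * z ^ (-s)
  growth : ∀ s : ℂ, c < s.re → ∃ (C : ℝ) (A : ℕ), ∀ z : ℂ, 0 ≤ z.re → 1 ≤ |z.im| →
    ‖H s z‖ ≤ C * ‖z‖ ^ A

theorem isOpen_setOf_lt_re (c : ℝ) : IsOpen {s : ℂ | c < s.re} :=
  isOpen_lt continuous_const Complex.continuous_re

theorem IsHurwitzFamily.mono {c d : ℝ} {H : ℂ → ℂ → ℂ} (h : IsHurwitzFamily c H) (hcd : c ≤ d) :
    IsHurwitzFamily d H where
  continuousOn := h.continuousOn.mono (prod_mono_left fun _ hs => hcd.trans_lt hs)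
  differentiableOn_left z hz := (h.differentiableOn_left z hz).mono fun _ hs => hcd.trans_lt hs
  differentiableOn_right s hs := h.differentiableOn_right s (hcd.trans_lt hs)
  sub_shift s hs := h.sub_shift s (hcd.trans_lt hs)
  growth s hs := h.growth s (hcd.trans_lt hs)

open Complex in
theorem IsHurwitzFamily.congr {c : ℝ} {H H' : ℂ → ℂ → ℂ} (h : IsHurwitzFamily c H)
    (hH : ∀ s : ℂ, c < s.re → ∀ z ∈ slitPlane, H' s z = H s z) : IsHurwitzFamily c H' where
  continuousOn := h.continuousOn.congr fun p hp => hH p.1 hp.1 p.2 hp.2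
  differentiableOn_left z hz := (h.differentiableOn_left z hz).congr fun s hs => hH s hs z hz
  differentiableOn_right s hs := (h.differentiableOn_right s hs).congr fun z hz => hH s hs z hz
  sub_shift s hs z hz := by
    rw [hH s hs z hz, hH s hs _ (by simpa using add_natCast_mem_slitPlane hz 1),
      h.sub_shift s hs z hz]
  growth s hs := by
    obtain ⟨C, A, hC⟩ := h.growth s hs
    refine ⟨C, A, fun z h0 h1 => ?_⟩
    rw [hH s hs z (Or.inr (by rintro h; simp [h] at h1; linarith))]
    exact hC z h0 h1

/-! ### The Hurwitz series for `Re s > 1` -/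

section Base

open Complex

/-- The first terms have no uniform bound near `z = 0, -1, …`. Dropping `M ≥ R + 1` of them forces
`Re (z + M) ≥ 1`, where a Weierstrass majorant exists; the dropped terms form a finite sum. -/
theorem exists_local_bound_hurwitz_tail (R σ T : ℝ) (hσ : 1 < σ) :
    ∃ (M : ℕ) (u : ℕ → ℝ), Summable u ∧ ∀ (n : ℕ) (z s : ℂ), ‖z‖ < R → σ < s.re → |s.im| < T →
      ‖(z + ((n + M : ℕ) : ℂ)) ^ (-s)‖ ≤ u n := by
  obtain ⟨M, hM⟩ := exists_nat_ge (R + 1)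
  refine ⟨M, _, (summable_natCast_add_one_rpow hσ).mul_right (Real.exp (Real.pi * T)),
    fun n z s hz hs hT => ?_⟩
  have hre := (abs_le.1 (Complex.abs_re_le_norm z)).1
  have := norm_add_natCast_cpow_le (z := z + M) n (zero_le_one.trans hσ.le) hs.le hT.le
    (by simp; linarith)
  rwa [show z + M + n = z + ((n + M : ℕ) : ℂ) by push_cast; ring] at this

theorem tsum_hurwitz_eq_sum_add_tail (M : ℕ) {z s : ℂ} (hs : 1 < s.re) :
    ∑' n : ℕ, (z + n) ^ (-s) =
      ∑ n ∈ Finset.range M, (z + n) ^ (-s) + ∑' n : ℕ, (z + ((n + M : ℕ) : ℂ)) ^ (-s) :=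
  ((summable_add_natCast_cpow hs).sum_add_tsum_nat_add M).symm

theorem continuousOn_hurwitz_series :
    ContinuousOn (fun p : ℂ × ℂ => ∑' n : ℕ, (p.2 + n) ^ (-p.1))
      ({s : ℂ | 1 < s.re} ×ˢ slitPlane) := by
  rintro ⟨s₀, z₀⟩ ⟨hs₀, hz₀⟩
  simp only [mem_ofPred_eq] at hs₀
  obtain ⟨M, u, hu, hb⟩ := exists_local_bound_hurwitz_tail (‖z₀‖ + 1) ((1 + s₀.re) / 2)
    (|s₀.im| + 1) (by linarith)
  set V : Set (ℂ × ℂ) := {p | ‖p.2‖ < ‖z₀‖ + 1} ∩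
    ({p | (1 + s₀.re) / 2 < p.1.re} ∩ {p | |p.1.im| < |s₀.im| + 1})
  have hVo : IsOpen V := by
    refine IsOpen.inter ?_ (IsOpen.inter ?_ ?_) <;> exact isOpen_lt (by fun_prop) (by fun_prop)
  have hmem : (s₀, z₀) ∈ V := ⟨by simp, by simp; linarith, by simp⟩
  have hterm : ∀ n : ℕ, ContinuousOn (fun p : ℂ × ℂ => (p.2 + n) ^ (-p.1))
      (({s : ℂ | 1 < s.re} ×ˢ slitPlane) ∩ V) := fun n =>
    ContinuousOn.cpow (by fun_prop) (by fun_prop) fun p hp =>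
      add_natCast_mem_slitPlane hp.1.2 n
  have hc : ContinuousOn (fun p : ℂ × ℂ => ∑' n : ℕ, (p.2 + n) ^ (-p.1))
      (({s : ℂ | 1 < s.re} ×ˢ slitPlane) ∩ V) := by
    refine ContinuousOn.congr (f := fun p : ℂ × ℂ => ∑ n ∈ Finset.range M, (p.2 + n) ^ (-p.1) +
      ∑' n : ℕ, (p.2 + ((n + M : ℕ) : ℂ)) ^ (-p.1)) ?_
      fun p hp => tsum_hurwitz_eq_sum_add_tail M hp.1.1
    refine (continuousOn_finsetSum _ fun n _ => hterm n).add
      (continuousOn_tsum (fun n => hterm (n + M)) hu fun n p hp =>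
        hb n p.2 p.1 hp.2.1 hp.2.2.1 hp.2.2.2)
  exact (hc (s₀, z₀) ⟨⟨hs₀, hz₀⟩, hmem⟩).mono_of_mem_nhdsWithin
    (inter_mem self_mem_nhdsWithin (mem_nhdsWithin_of_mem_nhds (hVo.mem_nhds hmem)))

theorem differentiableOn_hurwitz_series_left {z : ℂ} (hz : z ∈ slitPlane) :
    DifferentiableOn ℂ (fun s => ∑' n : ℕ, (z + n) ^ (-s)) {s : ℂ | 1 < s.re} := by
  intro s₀ hs₀
  simp only [mem_ofPred_eq] at hs₀
  obtain ⟨M, u, hu, hb⟩ := exists_local_bound_hurwitz_tail (‖z‖ + 1) ((1 + s₀.re) / 2)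
    (|s₀.im| + 1) (by linarith)
  set V : Set ℂ := {s | (1 + s₀.re) / 2 < s.re} ∩ {s | |s.im| < |s₀.im| + 1}
  have hVo : IsOpen V := by
    refine IsOpen.inter ?_ ?_ <;> exact isOpen_lt (by fun_prop) (by fun_prop)
  have hmem : s₀ ∈ V := ⟨by simp; linarith, by simp⟩
  have hterm : ∀ n : ℕ, DifferentiableOn ℂ (fun s : ℂ => (z + n) ^ (-s)) V := fun n s _ =>
    (DifferentiableAt.const_cpow (by fun_prop)
      (Or.inl (slitPlane_ne_zero (add_natCast_mem_slitPlane hz n)))).differentiableWithinAt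
  have hc : DifferentiableOn ℂ (fun s => ∑' n : ℕ, (z + n) ^ (-s)) V := by
    refine DifferentiableOn.congr (f := fun s : ℂ => ∑ n ∈ Finset.range M, (z + n) ^ (-s) +
      ∑' n : ℕ, (z + ((n + M : ℕ) : ℂ)) ^ (-s)) ?_
      fun s hs => tsum_hurwitz_eq_sum_add_tail M
        ((by linarith : (1 : ℝ) < (1 + s₀.re) / 2).trans hs.1)
    exact (DifferentiableOn.fun_sum fun n _ => hterm n).add
      (differentiableOn_tsum_of_summable_norm hu (fun n => hterm (n + M)) hVo fun n s hs =>
        hb n z s (by simp) hs.1 hs.2)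
  exact (hc.differentiableAt (hVo.mem_nhds hmem)).differentiableWithinAt

theorem differentiableOn_hurwitz_series_right {s : ℂ} (hs : 1 < s.re) :
    DifferentiableOn ℂ (fun z : ℂ => ∑' n : ℕ, (z + n) ^ (-s)) slitPlane := by
  intro z₀ hz₀
  obtain ⟨M, u, hu, hb⟩ := exists_local_bound_hurwitz_tail (‖z₀‖ + 1) ((1 + s.re) / 2)
    (|s.im| + 1) (by linarith)
  set V : Set ℂ := {z | ‖z‖ < ‖z₀‖ + 1} ∩ slitPlane
  have hVo : IsOpen V := (isOpen_lt (by fun_prop) (by fun_prop)).inter isOpen_slitPlane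
  have hmem : z₀ ∈ V := ⟨by simp, hz₀⟩
  have hterm : ∀ n : ℕ, DifferentiableOn ℂ (fun z : ℂ => (z + n) ^ (-s)) V := fun n z hz =>
    (DifferentiableAt.cpow_const (f := fun z : ℂ => z + n) (by fun_prop)
      (add_natCast_mem_slitPlane hz.2 n)).differentiableWithinAt
  have hc : DifferentiableOn ℂ (fun z : ℂ => ∑' n : ℕ, (z + n) ^ (-s)) V := by
    refine DifferentiableOn.congr (f := fun z : ℂ => ∑ n ∈ Finset.range M, (z + n) ^ (-s) +
      ∑' n : ℕ, (z + ((n + M : ℕ) : ℂ)) ^ (-s)) ?_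
      fun z _ => tsum_hurwitz_eq_sum_add_tail M hs
    exact (DifferentiableOn.fun_sum fun n _ => hterm n).add
      (differentiableOn_tsum_of_summable_norm hu (fun n => hterm (n + M)) hVo fun n z hz =>
        hb n z s hz.1 (by linarith) (by simp))
  exact (hc.differentiableAt (hVo.mem_nhds hmem)).differentiableWithinAt

theorem isHurwitzFamily_series :
    IsHurwitzFamily 1 fun s z => (s - 1) * ∑' n : ℕ, (z + n) ^ (-s) where
  continuousOn := ContinuousOn.mul (by fun_prop) continuousOn_hurwitz_series
  differentiableOn_left z hz :=
    DifferentiableOn.mul (by fun_prop) (differentiableOn_hurwitz_series_left hz)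
  differentiableOn_right s hs := (differentiableOn_hurwitz_series_right hs).const_mul _
  sub_shift s hs z hz := by
    rw [(summable_add_natCast_cpow hs).tsum_eq_zero_add]
    simp only [Nat.cast_add, Nat.cast_one, Nat.cast_zero, add_zero, add_assoc, add_comm (1 : ℂ)]
    ring
  growth s hs := by
    refine ⟨‖s - 1‖ * ∑' n : ℕ, ((n : ℝ) + 1) ^ (-s.re) *
      (2 ^ s.re * Real.exp (Real.pi * |s.im|)), 0, fun z hz hz' => ?_⟩
    rw [norm_mul, pow_zero, mul_one]
    gcongr
    exact tsum_of_norm_bounded ((summable_natCast_add_one_rpow hs).mul_right _).hasSum fun n =>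
      norm_add_natCast_cpow_le_of_one_le_im n (by linarith) hz hz'

end Base

/-! ### Continuation in `s`, one unit at a time -/

open Complex

/-- The operator that carries `(s - 1) ζ(s, z)` on `Re s > c` to its continuation on
`Re s > c - 1`. -/
noncomputable def hurwitzStep (H : ℂ → ℂ → ℂ) (s z : ℂ) : ℂ :=
  z ^ (1 - s) + (s - 1) * ∫ x in (0 : ℝ)..1, (1 - x) * H (s + 1) (z + x)

theorem intervalIntegrable_hurwitzStep {c : ℝ} {H : ℂ → ℂ → ℂ} (h : IsHurwitzFamily c H) {s z : ℂ}
    (hs : c - 1 < s.re) (hz : z ∈ slitPlane) :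
    IntervalIntegrable (fun x : ℝ => (1 - x) * H (s + 1) (z + x)) volume 0 1 := by
  refine ContinuousOn.intervalIntegrable_of_Icc zero_le_one (ContinuousOn.mul (by fun_prop) ?_)
  exact (h.differentiableOn_right (s + 1) (by simp; linarith)).continuousOn.comp (by fun_prop)
    fun x hx => add_ofReal_mem_slitPlane hz hx.1

theorem norm_add_ofReal_le_two_mul {z : ℂ} (hz : 1 ≤ |z.im|) {x : ℝ} (hx : x ∈ Icc (0 : ℝ) 1) :
    ‖z + x‖ ≤ 2 * ‖z‖ := by
  have h1 := hz.trans (Complex.abs_im_le_norm z)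
  have h2 := norm_add_le z x
  rw [Complex.norm_of_nonneg hx.1] at h2
  linarith [hx.2]

/-- Regularity passes through the integral over `[0, 1]`. Growth survives because `z + x` stays in
the region of the bound and `‖z + x‖ ≤ 2 ‖z‖` there. -/
theorem IsHurwitzFamily.step {c : ℝ} {H : ℂ → ℂ → ℂ} (h : IsHurwitzFamily c H) :
    IsHurwitzFamily (c - 1) (hurwitzStep H) := by
  have hcont : ContinuousOn (Function.uncurry fun (p : ℂ × ℂ) (x : ℝ) =>
      (1 - x) * H (p.1 + 1) (p.2 + x))
      (({s : ℂ | c - 1 < s.re} ×ˢ slitPlane) ×ˢ Icc (0 : ℝ) 1) := by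
    refine ContinuousOn.mul (by fun_prop) ?_
    exact h.continuousOn.comp (f := fun q : (ℂ × ℂ) × ℝ => (q.1.1 + 1, q.1.2 + (q.2 : ℂ)))
      (by fun_prop) fun q hq => ⟨by simpa [sub_lt_iff_lt_add] using hq.1.1,
        add_ofReal_mem_slitPlane hq.1.2 hq.2.1⟩
  refine ⟨?_, fun z hz => ?_, fun s hs => ?_, fun s hs z hz => ?_, fun s hs => ?_⟩
  · refine ContinuousOn.add (ContinuousOn.cpow (by fun_prop) (by fun_prop) fun p hp => hp.2) ?_
    exact ContinuousOn.mul (by fun_prop) (continuousOn_intervalIntegral_of_continuousOn_prod hcont)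
  · refine DifferentiableOn.add (fun s _ => DifferentiableAt.differentiableWithinAt
      (DifferentiableAt.const_cpow (by fun_prop) (Or.inl (slitPlane_ne_zero hz)))) ?_
    refine DifferentiableOn.mul (by fun_prop)
      (differentiableOn_intervalIntegral_of_continuousOn_prod (isOpen_setOf_lt_re _) ?_ ?_)
    · exact hcont.comp (f := fun q : ℂ × ℝ => ((q.1, z), q.2)) (by fun_prop)
        fun q hq => ⟨⟨hq.1, hz⟩, hq.2⟩
    · intro x hx
      refine DifferentiableOn.const_mul ?_ _
      exact (h.differentiableOn_left _ (add_ofReal_mem_slitPlane hz hx.1)).comp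
        (f := fun s : ℂ => s + 1) (by fun_prop)
        fun s hs => by simpa [sub_lt_iff_lt_add] using hs
  · refine DifferentiableOn.add (fun z hz => DifferentiableAt.differentiableWithinAt
      (DifferentiableAt.cpow_const (f := fun z : ℂ => z) (by fun_prop) hz)) ?_
    refine DifferentiableOn.const_mul
      (differentiableOn_intervalIntegral_of_continuousOn_prod isOpen_slitPlane ?_ ?_) _
    · exact hcont.comp (f := fun q : ℂ × ℝ => ((s, q.1), q.2)) (by fun_prop)
        fun q hq => ⟨⟨hs, hq.1⟩, hq.2⟩
    · intro x hx
      refine DifferentiableOn.const_mul ?_ _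
      exact (h.differentiableOn_right (s + 1) (by simp; linarith)).comp
        (f := fun z : ℂ => z + x) (by fun_prop) fun z hz => add_ofReal_mem_slitPlane hz hx.1
  · have hz1 : z + 1 ∈ slitPlane := by simpa using add_natCast_mem_slitPlane hz 1
    have hint := intervalIntegral.integral_sub (intervalIntegrable_hurwitzStep h hs hz)
      (intervalIntegrable_hurwitzStep h hs hz1)
    -- The difference equation at `s + 1` reduces the difference of the two integrals to the Taylor
    -- remainder of a single power.
    have hcongr : ∫ x in (0 : ℝ)..1, ((1 - x) * H (s + 1) (z + x) -
        (1 - x) * H (s + 1) (z + 1 + x)) =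
        ∫ x in (0 : ℝ)..1, (1 - x) * (s * (z + x) ^ (-(s + 1))) := by
      refine intervalIntegral.integral_congr fun x hx => ?_
      rw [uIcc_of_le zero_le_one] at hx
      have := h.sub_shift (s + 1) (by simp; linarith) _ (add_ofReal_mem_slitPlane hz hx.1)
      rw [← mul_sub, show z + 1 + x = z + x + 1 by ring, this]
      ring
    have key := integral_one_sub_mul_cpow hz s
    rw [← hcongr, hint] at key
    simp only [hurwitzStep]
    linear_combination key
  · obtain ⟨C, A, hC⟩ := h.growth (s + 1) (by simp; linarith)
    obtain ⟨B, hB⟩ := exists_nat_ge (1 - s).re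
    set K := Real.exp (Real.pi * |(1 - s).im|)
    have hK : 0 ≤ K := (Real.exp_pos _).le
    refine ⟨K + ‖s - 1‖ * (|C| * 2 ^ A), A + B, fun z hz hz' => ?_⟩
    have hz1 : 1 ≤ ‖z‖ := hz'.trans (Complex.abs_im_le_norm z)
    have h1 : ‖z ^ (1 - s)‖ ≤ K * ‖z‖ ^ (A + B) := by
      refine (norm_cpow_le_mul_exp _ _).trans ?_
      rw [mul_comm]
      gcongr
      rw [← Real.rpow_natCast]
      refine Real.rpow_le_rpow_of_exponent_le hz1 (hB.trans ?_)
      push_cast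
      linarith [A.cast_nonneg (α := ℝ)]
    have h2 : ‖∫ x in (0 : ℝ)..1, (1 - x) * H (s + 1) (z + x)‖ ≤
        |C| * 2 ^ A * ‖z‖ ^ (A + B) := by
      have := intervalIntegral.norm_integral_le_of_norm_le_const (a := (0 : ℝ)) (b := 1)
        (C := |C| * 2 ^ A * ‖z‖ ^ (A + B))
        (f := fun x : ℝ => (1 - x) * H (s + 1) (z + x)) fun x hx => ?_
      · simpa using this
      rw [uIoc_of_le zero_le_one] at hx
      have hx' := Ioc_subset_Icc_self hx
      rw [norm_mul]
      have h3 : ‖(1 - x : ℂ)‖ ≤ 1 := by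
        rw [← ofReal_one, ← ofReal_sub, Complex.norm_of_nonneg (by linarith [hx.2])]
        linarith [hx.1]
      have h4 := hC (z + x) (by simp; linarith [hx.1]) (by simpa using hz')
      calc ‖(1 - x : ℂ)‖ * ‖H (s + 1) (z + x)‖ ≤ 1 * (|C| * (2 * ‖z‖) ^ A) := by
            gcongr
            refine h4.trans ?_
            gcongr
            · exact le_abs_self C
            · exact norm_add_ofReal_le_two_mul hz' hx'
        _ = |C| * 2 ^ A * ‖z‖ ^ A := by rw [mul_pow]; ring
        _ ≤ _ := by gcongr; exact Nat.le_add_right _ _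
    calc _ ≤ ‖z ^ (1 - s)‖ + ‖s - 1‖ * ‖∫ x in (0 : ℝ)..1, (1 - x) * H (s + 1) (z + x)‖ := by
          rw [hurwitzStep, ← norm_mul]; exact norm_add_le _ _
      _ ≤ K * ‖z‖ ^ (A + B) + ‖s - 1‖ * (|C| * 2 ^ A * ‖z‖ ^ (A + B)) := by gcongr
      _ = _ := by ring

theorem tendsto_add_natCast_cpow_nhds_zero (z : ℂ) {p : ℂ} (hp : p.re < 0) :
    Tendsto (fun n : ℕ => (z + n) ^ p) atTop (𝓝 0) := by
  have h : Tendsto (fun n : ℕ => ‖z + n‖) atTop atTop := by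
    refine tendsto_atTop_mono (f := fun n : ℕ => z.re + n) (fun n => ?_)
      (tendsto_atTop_add_const_left _ _ tendsto_natCast_atTop_atTop)
    exact le_trans (by simp) (Complex.re_le_norm _)
  have h2 : Tendsto (fun n : ℕ => ‖z + n‖ ^ p.re * Real.exp (Real.pi * |p.im|)) atTop (𝓝 0) := by
    have := ((tendsto_rpow_neg_atTop (neg_pos.2 hp)).comp h).mul_const
      (Real.exp (Real.pi * |p.im|))
    simpa using this
  exact squeeze_zero_norm (fun n => norm_cpow_le_mul_exp _ _) h2

theorem hasSum_hurwitzStep_series {s z : ℂ} (hs : 1 < s.re) (hz : 1 ≤ z.re) :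
    HasSum (fun n : ℕ => ∫ x in (0 : ℝ)..1, (1 - x) * (s * (z + n + x) ^ (-(s + 1))))
      (∫ x in (0 : ℝ)..1, (1 - x) * (s * ∑' n : ℕ, (z + x + n) ^ (-(s + 1)))) := by
  have hz0 : z ∈ slitPlane := Or.inl (by linarith)
  refine intervalIntegral.hasSum_integral_of_dominated_convergence
    (fun n _ => ‖s‖ * (((n : ℝ) + 1) ^ (-(s.re + 1)) * Real.exp (Real.pi * |s.im|)))
    (fun n => ?_) (fun n => ?_) ?_ ?_ ?_
  · refine (ContinuousOn.intervalIntegrable_of_Icc zero_le_one ?_).def'.aestronglyMeasurable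
    have := continuousOn_add_ofReal_cpow (add_natCast_mem_slitPlane hz0 n) (-(s + 1))
    fun_prop
  · refine Eventually.of_forall fun x hx => ?_
    rw [uIoc_of_le zero_le_one] at hx
    have h3 : ‖(1 - x : ℂ)‖ ≤ 1 := by
      rw [← ofReal_one, ← ofReal_sub, Complex.norm_of_nonneg (by linarith [hx.2])]
      linarith [hx.1]
    have h4 := norm_add_natCast_cpow_le (z := z + x) (s := s + 1) n (σ := s.re + 1)
      (T := |s.im|) (by linarith) (by simp) (by simp) (by simp; linarith [hx.1])
    rw [norm_mul, norm_mul, show z + n + x = z + x + n by ring]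
    calc _ ≤ 1 * (‖s‖ * (((n : ℝ) + 1) ^ (-(s.re + 1)) * Real.exp (Real.pi * |s.im|))) := by
          gcongr
      _ = _ := one_mul _
  · exact Eventually.of_forall fun x _ =>
      ((summable_natCast_add_one_rpow (by linarith)).mul_right _).mul_left _
  · exact intervalIntegrable_const
  · refine Eventually.of_forall fun x _ => ?_
    have := (summable_add_natCast_cpow (z := z + x) (s := s + 1) (by simp; linarith)).hasSum
    refine ((this.mul_left s).mul_left (1 - x : ℂ)).congr_fun fun n => ?_
    rw [add_right_comm z]

/-- Taylor's formula at each `z + n`, summed over `n`: the terms `(z + n + 1) ^ (1 - s) - (z + n) ^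
(1 - s)` telescope to `-z ^ (1 - s)`. -/
theorem hurwitzStep_series_of_one_le_re {s z : ℂ} (hs : 1 < s.re) (hz : 1 ≤ z.re) :
    hurwitzStep (fun s z => (s - 1) * ∑' n : ℕ, (z + n) ^ (-s)) s z =
      (s - 1) * ∑' n : ℕ, (z + n) ^ (-s) := by
  have hz0 : z ∈ slitPlane := Or.inl (by linarith)
  have h1 := (hasSum_hurwitzStep_series hs hz).mul_left (s - 1)
  have h2 : HasSum (fun n : ℕ => (z + (n + 1 : ℕ)) ^ (1 - s) - (z + n) ^ (1 - s))
      (0 - (z + (0 : ℕ)) ^ (1 - s)) := by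
    have ht := tendsto_add_natCast_cpow_nhds_zero z (p := 1 - s) (by simp; linarith)
    have hs' : Summable fun n : ℕ => (z + (n + 1 : ℕ)) ^ (1 - s) - (z + n) ^ (1 - s) := by
      have e : (fun n : ℕ => (z + (n + 1 : ℕ)) ^ (1 - s) - (z + n) ^ (1 - s)) = fun n : ℕ =>
          (s - 1) * (∫ x in (0 : ℝ)..1, (1 - x) * (s * (z + n + x) ^ (-(s + 1)))) -
            (s - 1) * (z + n) ^ (-s) := by
        ext n
        rw [integral_one_sub_mul_cpow (add_natCast_mem_slitPlane hz0 n)]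
        push_cast
        ring_nf
      rw [e]
      exact h1.summable.sub ((summable_add_natCast_cpow hs).mul_left _)
    refine (hs'.hasSum_iff_tendsto_nat).2 ?_
    simp only [Finset.sum_range_sub (fun n : ℕ => (z + (n : ℂ)) ^ (1 - s))]
    exact ht.sub_const _
  have h3 := ((summable_add_natCast_cpow (z := z) hs).hasSum.mul_left (s - 1)).add h2
  have h4 := h1.unique (h3.congr_fun fun n => ?_)
  · simp only [hurwitzStep, add_sub_cancel_right]
    simp only [h4]
    simp
  · rw [integral_one_sub_mul_cpow (add_natCast_mem_slitPlane hz0 n)]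
    push_cast
    ring_nf

/-- Both functions satisfy the same difference equation, so their difference is unchanged by `z ↦ z
+ 1`, and some integer translate of `z` has real part at least 1. -/
theorem eq_of_isHurwitzFamily_of_eq_of_one_le_re {c : ℝ} {H H' : ℂ → ℂ → ℂ}
    (h : IsHurwitzFamily c H) (h' : IsHurwitzFamily c H') {s : ℂ} (hs : c < s.re)
    (heq : ∀ z : ℂ, 1 ≤ z.re → H s z = H' s z) {z : ℂ} (hz : z ∈ slitPlane) :
    H s z = H' s z := by
  have hshift : ∀ n : ℕ, H s z - H s (z + n) = H' s z - H' s (z + n) := by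
    intro n
    induction n with
    | zero => simp
    | succ n ih =>
      have h1 := h.sub_shift s hs _ (add_natCast_mem_slitPlane hz n)
      have h2 := h'.sub_shift s hs _ (add_natCast_mem_slitPlane hz n)
      push_cast
      rw [← add_assoc]
      linear_combination ih + h1 - h2
  obtain ⟨M, hM⟩ := exists_nat_ge (1 - z.re)
  have := hshift M
  rw [heq (z + M) (by simp; linarith)] at this
  exact sub_left_injective this

theorem hurwitzStep_series {s z : ℂ} (hs : 1 < s.re) (hz : z ∈ slitPlane) :
    hurwitzStep (fun s z => (s - 1) * ∑' n : ℕ, (z + n) ^ (-s)) s z =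
      (s - 1) * ∑' n : ℕ, (z + n) ^ (-s) :=
  eq_of_isHurwitzFamily_of_eq_of_one_le_re
    (isHurwitzFamily_series.step.mono (by norm_num)) isHurwitzFamily_series hs
    (fun _ hz => hurwitzStep_series_of_one_le_re hs hz) hz

/-- The function `(s - 1) ζ(s, z)` for `Re s > 1 - j`. -/
noncomputable def hurwitzApprox (j : ℕ) : ℂ → ℂ → ℂ :=
  hurwitzStep^[j] fun s z => (s - 1) * ∑' n : ℕ, (z + n) ^ (-s)

theorem hurwitzApprox_succ (j : ℕ) : hurwitzApprox (j + 1) = hurwitzStep (hurwitzApprox j) :=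
  Function.iterate_succ_apply' _ _ _

theorem isHurwitzFamily_hurwitzApprox (j : ℕ) : IsHurwitzFamily (1 - j) (hurwitzApprox j) := by
  induction j with
  | zero => simpa using! isHurwitzFamily_series
  | succ j ih =>
    rw [hurwitzApprox_succ]
    exact ih.step.mono (by push_cast; linarith)

/-- `hurwitzStep` reads its argument only at `s + 1`, so agreement on one half-plane extends one
unit to the left. -/
theorem hurwitzApprox_succ_eq (j : ℕ) {s z : ℂ} (hs : 1 - (j : ℝ) < s.re) (hz : z ∈ slitPlane) :
    hurwitzApprox (j + 1) s z = hurwitzApprox j s z := by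
  induction j generalizing s z with
  | zero => exact hurwitzStep_series (by simpa using hs) hz
  | succ j ih =>
    rw [hurwitzApprox_succ, hurwitzApprox_succ, hurwitzStep, hurwitzStep]
    congr 2
    refine intervalIntegral.integral_congr fun x hx => ?_
    rw [uIcc_of_le zero_le_one] at hx
    rw [← hurwitzApprox_succ, ih (by push_cast at hs; simp; linarith)
      (add_ofReal_mem_slitPlane hz hx.1)]

theorem hurwitzApprox_eq_of_le {i j : ℕ} (hij : i ≤ j) {s z : ℂ} (hs : 1 - (i : ℝ) < s.re)
    (hz : z ∈ slitPlane) : hurwitzApprox j s z = hurwitzApprox i s z := by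
  induction j, hij using Nat.le_induction with
  | base => rfl
  | succ j hij ih =>
    rw [hurwitzApprox_succ_eq j ?_ hz, ih]
    have : (i : ℝ) ≤ j := by exact_mod_cast hij
    linarith

/-- The entire function `s ↦ (s - 1) ζ(s, z)`. -/
noncomputable def hurwitzEntire (s z : ℂ) : ℂ :=
  hurwitzApprox (⌊1 - s.re⌋₊ + 1) s z

theorem hurwitzEntire_eq (j : ℕ) {s z : ℂ} (hs : 1 - (j : ℝ) < s.re) (hz : z ∈ slitPlane) :
    hurwitzEntire s z = hurwitzApprox j s z := by
  have h := Nat.lt_floor_add_one (1 - s.re)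
  rcases le_total j (⌊1 - s.re⌋₊ + 1) with hj | hj
  · exact hurwitzApprox_eq_of_le hj hs hz
  · exact (hurwitzApprox_eq_of_le hj (by push_cast; linarith) hz).symm

theorem isHurwitzFamily_hurwitzEntire (c : ℝ) : IsHurwitzFamily c hurwitzEntire := by
  obtain ⟨j, hj⟩ := exists_nat_ge (1 - c)
  exact ((isHurwitzFamily_hurwitzApprox j).mono (by linarith)).congr fun s hs z hz =>
    hurwitzEntire_eq j (by linarith) hz

theorem differentiable_hurwitzEntire {z : ℂ} (hz : z ∈ slitPlane) :
    Differentiable ℂ fun s => hurwitzEntire s z := fun s =>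
  ((isHurwitzFamily_hurwitzEntire (s.re - 1)).differentiableOn_left z hz).differentiableAt
    ((isOpen_setOf_lt_re _).mem_nhds (by simp))

theorem isHurwitzZeta_hurwitzEntire {z : ℂ} (hz : z ∈ slitPlane) :
    IsHurwitzZeta z fun s => hurwitzEntire s z / (s - 1) := by
  refine ⟨(differentiable_hurwitzEntire hz).differentiableOn.div (by fun_prop)
    fun s hs => sub_ne_zero.2 hs, fun s hs => ?_⟩
  have hs1 : s - 1 ≠ 0 := sub_ne_zero.2 (by rintro rfl; simp at hs)
  change HasSum _ (hurwitzEntire s z / (s - 1))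
  rw [hurwitzEntire_eq 0 (by simpa using hs) hz]
  simp only [hurwitzApprox, Function.iterate_zero, id]
  rw [mul_div_cancel_left₀ _ hs1]
  exact (summable_add_natCast_cpow hs).hasSum

theorem IsHurwitzZeta.eqOn {z : ℂ} {g h : ℂ → ℂ} (hg : IsHurwitzZeta z g)
    (hh : IsHurwitzZeta z h) : EqOn g h {1}ᶜ := by
  refine (hg.1.analyticOnNhd isOpen_compl_singleton).eqOn_of_preconnected_of_eventuallyEq
    (hh.1.analyticOnNhd isOpen_compl_singleton)
    (isConnected_compl_singleton_of_one_lt_rank (by simp) 1).isPreconnected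
    (z₀ := 2) (by simp) ?_
  filter_upwards [(isOpen_setOf_lt_re 1).mem_nhds (show (2 : ℂ) ∈ {s : ℂ | 1 < s.re} by simp)]
    with s hs
  exact (hg.2 s hs).unique (hh.2 s hs)

/-- The identity theorem makes the choice in `hurwitz` immaterial away from `s = 1`; from here on
the explicit continuation replaces it. -/
theorem hurwitz_eq {s z : ℂ} (hs : s ≠ 1) (hz : z ∈ slitPlane) :
    hurwitz s z = hurwitzEntire s z / (s - 1) := by
  have h : ∃ g : ℂ → ℂ, IsHurwitzZeta z g := ⟨_, isHurwitzZeta_hurwitzEntire hz⟩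
  rw [hurwitz, dif_pos h]
  exact h.choose_spec.eqOn (isHurwitzZeta_hurwitzEntire hz) hs

theorem hurwitz_sub_shift {s z : ℂ} (hs : s ≠ 1) (hz : z ∈ slitPlane) :
    hurwitz s z - hurwitz s (z + 1) = z ^ (-s) := by
  have hs1 : s - 1 ≠ 0 := sub_ne_zero.2 hs
  rw [hurwitz_eq hs hz, hurwitz_eq hs (by simpa using add_natCast_mem_slitPlane hz 1), ← sub_div,
    (isHurwitzFamily_hurwitzEntire (s.re - 1)).sub_shift s (by simp) z hz,
    mul_div_cancel_left₀ _ hs1]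

theorem differentiableOn_hurwitz_right {s : ℂ} (hs : s ≠ 1) :
    DifferentiableOn ℂ (hurwitz s) slitPlane :=
  (((isHurwitzFamily_hurwitzEntire (s.re - 1)).differentiableOn_right s (by simp)).div_const
    (s - 1)).congr fun _ hz => hurwitz_eq hs hz

theorem differentiableOn_hurwitz_left {z : ℂ} (hz : z ∈ slitPlane) :
    DifferentiableOn ℂ (fun s => hurwitz s z) {1}ᶜ :=
  (isHurwitzZeta_hurwitzEntire hz).1.congr fun _ hs => hurwitz_eq hs hz

theorem continuousOn_hurwitz :
    ContinuousOn (Function.uncurry hurwitz) ({1}ᶜ ×ˢ slitPlane) := by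
  refine ContinuousOn.congr (f := fun p : ℂ × ℂ => hurwitzEntire p.1 p.2 / (p.1 - 1)) ?_
    fun p hp => hurwitz_eq hp.1 hp.2
  refine ContinuousOn.div (fun p hp => ?_) (by fun_prop) fun p hp => sub_ne_zero.2 hp.1
  have h := (isHurwitzFamily_hurwitzEntire (p.1.re - 1)).continuousOn
  refine ((h.continuousAt ?_).continuousWithinAt :)
  exact prod_mem_nhds ((isOpen_setOf_lt_re _).mem_nhds (by simp)) (isOpen_slitPlane.mem_nhds hp.2)

theorem exists_growth_hurwitz {s : ℂ} (hs : s ≠ 1) : ∃ (C : ℝ) (A : ℕ), ∀ z : ℂ, 0 ≤ z.re →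
    1 ≤ |z.im| → ‖hurwitz s z‖ ≤ C * ‖z‖ ^ A := by
  obtain ⟨C, A, hC⟩ := (isHurwitzFamily_hurwitzEntire (s.re - 1)).growth s (by simp)
  refine ⟨C / ‖s - 1‖, A, fun z h0 h1 => ?_⟩
  rw [hurwitz_eq hs (Or.inr (by rintro h; simp [h] at h1; linarith)), norm_div, div_mul_eq_mul_div]
  gcongr
  exact hC z h0 h1

/-! ### The exponential integral as a Fourier integral of the Hurwitz zeta function -/

/-- The entire function `w ↦ ∑ wʳ / (r! (s + r))`, which is `∫_0^1 t^{s-1} e^{wt} dt` for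
`Re s > 0`. -/
noncomputable def lowerGammaSeries (s w : ℂ) : ℂ :=
  ∑' r : ℕ, w ^ r / ((Nat.factorial r : ℂ) * (s + (r : ℂ)))

theorem re_le_norm_add_natCast {s : ℂ} (r : ℕ) : s.re ≤ ‖s + r‖ :=
  le_trans (by simp) (Complex.re_le_norm _)

theorem add_natCast_ne_zero {s : ℂ} (hs : 0 < s.re) (r : ℕ) : s + r ≠ 0 :=
  norm_pos_iff.1 (hs.trans_le (re_le_norm_add_natCast r))

theorem norm_lowerGammaSeries_term_le {s : ℂ} (hs : 0 < s.re) {w : ℂ} {R : ℝ} (hw : ‖w‖ ≤ R)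
    (r : ℕ) : ‖w ^ r / ((Nat.factorial r : ℂ) * (s + (r : ℂ)))‖ ≤
      R ^ r / Nat.factorial r * (1 / s.re) := by
  rw [norm_div, norm_mul, norm_pow, Complex.norm_natCast, ← div_div, div_eq_mul_one_div]
  have := re_le_norm_add_natCast r (s := s)
  have hR := (norm_nonneg w).trans hw
  gcongr

theorem summable_lowerGammaSeries {s : ℂ} (hs : 0 < s.re) (w : ℂ) :
    Summable fun r : ℕ => w ^ r / ((Nat.factorial r : ℂ) * (s + (r : ℂ))) :=
  Summable.of_norm_bounded ((Real.summable_pow_div_factorial ‖w‖).mul_right _)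
    (norm_lowerGammaSeries_term_le hs le_rfl)

theorem differentiable_lowerGammaSeries {s : ℂ} (hs : 0 < s.re) :
    Differentiable ℂ (lowerGammaSeries s) := fun w =>
  (differentiableOn_tsum_of_summable_norm
    ((Real.summable_pow_div_factorial (‖w‖ + 1)).mul_right (1 / s.re))
    (fun r => by fun_prop) Metric.isOpen_ball fun r v hv =>
      norm_lowerGammaSeries_term_le hs (mem_ball_zero_iff.1 hv).le r).differentiableAt
    (Metric.isOpen_ball.mem_nhds (mem_ball_zero_iff.2 (lt_add_one _)))

/-- The operator `s + w d/dw` multiplies `w ^ r` by `s + r` and so cancels the denominators. This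
makes `z ^ s * lowerGammaSeries s (κ * z)` a primitive of `exp (κ * z) * z ^ (s - 1)`. -/
theorem mul_lowerGammaSeries_add_mul_deriv {s : ℂ} (hs : 0 < s.re) (w : ℂ) :
    s * lowerGammaSeries s w + w * deriv (lowerGammaSeries s) w = exp w := by
  have h1 := hasSum_deriv_of_summable_norm (z := w)
    (F := fun (r : ℕ) (w : ℂ) => w ^ r / ((Nat.factorial r : ℂ) * (s + (r : ℂ))))
    ((Real.summable_pow_div_factorial (‖w‖ + 1)).mul_right (1 / s.re))
    (fun r => by fun_prop) Metric.isOpen_ball (fun r v hv =>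
      norm_lowerGammaSeries_term_le hs (mem_ball_zero_iff.1 hv).le r)
    (mem_ball_zero_iff.2 (lt_add_one _))
  have h2 := ((summable_lowerGammaSeries hs w).hasSum.mul_left s).add (h1.mul_left w)
  refine h2.unique ?_
  rw [Complex.exp_eq_exp_ℂ]
  refine (NormedSpace.expSeries_div_hasSum_exp w).congr_fun fun r => ?_
  have hr := add_natCast_ne_zero hs r
  have hf : (Nat.factorial r : ℂ) ≠ 0 := by exact_mod_cast r.factorial_ne_zero
  have hw : w * (r * w ^ (r - 1)) = r * w ^ r := by
    rcases r with _ | r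
    · simp
    · simp only [Nat.add_sub_cancel]; ring
  rw [deriv_div_const, deriv_pow_field, ← mul_div_assoc, ← mul_div_assoc, hw]
  field_simp

theorem hasDerivAt_cpow_mul_lowerGammaSeries {s : ℂ} (hs : 0 < s.re) (κ : ℂ) {z : ℂ}
    (hz : z ∈ slitPlane) :
    HasDerivAt (fun z => z ^ s * lowerGammaSeries s (κ * z)) (exp (κ * z) * z ^ (s - 1)) z := by
  have h1 : HasDerivAt (fun z : ℂ => z ^ s) (s * z ^ (s - 1) * 1) z :=
    (hasDerivAt_id z).cpow_const hz
  have h2 : HasDerivAt (fun z => lowerGammaSeries s (κ * z))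
      (deriv (lowerGammaSeries s) (κ * z) * (κ * 1)) z :=
    ((differentiable_lowerGammaSeries hs _).hasDerivAt).comp z ((hasDerivAt_id z).const_mul κ)
  refine (h1.mul h2).congr_deriv ?_
  rw [← mul_lowerGammaSeries_add_mul_deriv hs (κ * z)]
  have h3 : z ^ s = z ^ (s - 1) * z := by
    rw [cpow_sub _ _ (slitPlane_ne_zero hz), cpow_one, div_mul_cancel₀ _ (slitPlane_ne_zero hz)]
  rw [h3]
  ring

theorem hasDerivAt_integral_add {g : ℂ → ℂ} (hg : DifferentiableOn ℂ g slitPlane) {z : ℂ}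
    (hz : z ∈ slitPlane) :
    HasDerivAt (fun z => ∫ x in (0 : ℝ)..1, g (z + x)) (g (z + 1) - g z) z := by
  have hc : ∀ {g : ℂ → ℂ}, ContinuousOn g slitPlane →
      ContinuousOn (Function.uncurry fun (z : ℂ) (x : ℝ) => g (z + x)) (slitPlane ×ˢ Icc 0 1) :=
    fun hg => hg.comp (f := fun q : ℂ × ℝ => q.1 + (q.2 : ℂ)) (by fun_prop)
      fun q hq => add_ofReal_mem_slitPlane hq.1 hq.2.1
  have h := hasDerivAt_intervalIntegral_of_continuousOn_prod isOpen_slitPlane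
    (hc hg.continuousOn) (fun x hx => hg.comp (f := fun z : ℂ => z + x) (by fun_prop)
      fun z hz => add_ofReal_mem_slitPlane hz hx.1) hz
  refine h.congr_deriv ?_
  simp only [deriv_comp_add_const]
  have hd : ∀ x ∈ uIcc (0 : ℝ) 1, HasDerivAt (fun x : ℝ => g (z + x)) (deriv g (z + x)) x := by
    intro x hx
    rw [uIcc_of_le zero_le_one] at hx
    have h1 := (hg.differentiableAt (isOpen_slitPlane.mem_nhds
      (add_ofReal_mem_slitPlane hz hx.1))).hasDerivAt
    have h2 : HasDerivAt (fun y : ℂ => g (z + y)) (deriv g (z + x)) (x : ℂ) := h1.comp_const_add z x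
    exact h2.comp_ofReal
  rw [intervalIntegral.integral_eq_sub_of_hasDerivAt hd
    (intervalIntegrable_of_continuousOn_prod (hc (hg.deriv isOpen_slitPlane).continuousOn) hz)]
  simp

theorem isPreconnected_slitPlane : IsPreconnected slitPlane :=
  (starConvex_one_slitPlane.isPathConnected one_mem_slitPlane).isConnected.isPreconnected

/-- `∫_z^{z+1} e^{2πint} ζ(1 - s, t) dt`. -/
noncomputable def hurwitzFourier (n : ℤ) (s z : ℂ) : ℂ :=
  ∫ x in (0 : ℝ)..1, exp (2 * Real.pi * I * n * (z + x)) * hurwitz (1 - s) (z + x)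

theorem hasDerivAt_hurwitzFourier (n : ℤ) {s z : ℂ} (hs : 0 < s.re) (hz : z ∈ slitPlane) :
    HasDerivAt (hurwitzFourier n s) (-(exp (2 * Real.pi * I * n * z) * z ^ (s - 1))) z := by
  have hs1 : 1 - s ≠ 1 := by
    rintro h; rw [sub_eq_self] at h; simp [h] at hs
  have h := hasDerivAt_integral_add (g := fun t => exp (2 * Real.pi * I * n * t) *
    hurwitz (1 - s) t) (DifferentiableOn.mul (by fun_prop) (differentiableOn_hurwitz_right hs1)) hz
  refine h.congr_deriv ?_
  have h1 : exp (2 * Real.pi * I * n * (z + 1)) = exp (2 * Real.pi * I * n * z) := by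
    rw [mul_add, mul_one, exp_add, show 2 * Real.pi * I * n = n * (2 * Real.pi * I) by ring,
      exp_int_mul_two_pi_mul_I, mul_one]
  have h2 := hurwitz_sub_shift hs1 hz
  rw [neg_sub] at h2
  rw [h1, ← h2]
  ring

theorem exists_hurwitzFourier_add_eq (n : ℤ) {s : ℂ} (hs : 0 < s.re) :
    ∃ c : ℂ, ∀ z ∈ slitPlane,
      hurwitzFourier n s z + z ^ s * lowerGammaSeries s (2 * Real.pi * I * n * z) = c := by
  have h : ∀ z ∈ slitPlane, HasDerivAt (fun z => hurwitzFourier n s z +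
      z ^ s * lowerGammaSeries s (2 * Real.pi * I * n * z)) 0 z := fun z hz =>
    ((hasDerivAt_hurwitzFourier n hs hz).add
      (hasDerivAt_cpow_mul_lowerGammaSeries hs _ hz)).congr_deriv (neg_add_cancel _)
  exact isOpen_slitPlane.exists_is_const_of_deriv_eq_zero isPreconnected_slitPlane
    (fun z hz => (h z hz).differentiableAt.differentiableWithinAt) fun z hz => (h z hz).deriv

/-- Here `ε` is the sign of `n`: it selects the direction `±i∞` in which `e^{2πinz}` decays and
beats the polynomial growth of `ζ`. -/
theorem tendsto_hurwitzFourier_nhds_zero {n : ℤ} {s : ℂ} (hs : s ≠ 0) {ε : ℝ} (hε : |ε| = 1)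
    (hn : 0 < ε * n) :
    Tendsto (fun y : ℝ => hurwitzFourier n s (y * (ε * I))) atTop (𝓝 0) := by
  obtain ⟨C, A, hC⟩ := exists_growth_hurwitz (s := 1 - s) (by simpa using hs)
  have hb : 0 < 2 * Real.pi * (ε * n) := by positivity
  have hlim : Tendsto (fun y : ℝ => |C| * 2 ^ A * (y ^ (A : ℝ) *
      Real.exp (-(2 * Real.pi * (ε * n)) * y))) atTop (𝓝 0) := by
    simpa using (tendsto_rpow_mul_exp_neg_mul_atTop_nhds_zero A _ hb).const_mul (|C| * 2 ^ A)
  refine squeeze_zero_norm' ?_ hlim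
  filter_upwards [eventually_ge_atTop 1] with y hy
  have him : |((y : ℂ) * (ε * I)).im| = y := by
    simp [abs_mul, hε, abs_of_nonneg (zero_le_one.trans hy)]
  have hnorm : ‖(y : ℂ) * (ε * I)‖ = y := by
    simp [hε, abs_of_nonneg (zero_le_one.trans hy)]
  have := intervalIntegral.norm_integral_le_of_norm_le_const (a := (0 : ℝ)) (b := 1)
    (C := |C| * 2 ^ A * (y ^ (A : ℝ) * Real.exp (-(2 * Real.pi * (ε * n)) * y)))
    (f := fun x : ℝ => exp (2 * Real.pi * I * n * (y * (ε * I) + x)) *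
      hurwitz (1 - s) (y * (ε * I) + x)) fun x hx => ?_
  · simpa using! this
  rw [uIoc_of_le zero_le_one] at hx
  have hx' := Ioc_subset_Icc_self hx
  have h1 := hC (y * (ε * I) + x) (by simp; exact hx.1.le) (by rw [add_im, ofReal_im, add_zero, him]; exact hy)
  have h2 := norm_add_ofReal_le_two_mul (him.symm ▸ hy) hx'
  rw [hnorm] at h2
  rw [norm_mul, norm_exp]
  have h3 : (2 * Real.pi * I * n * (y * (ε * I) + x)).re = -(2 * Real.pi * (ε * n)) * y := by
    simp; ring
  rw [h3, Real.rpow_natCast]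
  calc _ ≤ Real.exp (-(2 * Real.pi * (ε * n)) * y) * (|C| * (2 * y) ^ A) := by
        gcongr
        refine h1.trans ?_
        gcongr
        exact le_abs_self C
    _ = _ := by rw [mul_pow]; ring

theorem hurwitzFourier_add_eq {n : ℤ} {s : ℂ} (hs : 0 < s.re) {ε : ℝ} (hε : |ε| = 1)
    (hn : 0 < ε * n) {z : ℂ} (hz : z ∈ slitPlane) :
    hurwitzFourier n s z + z ^ s * lowerGammaSeries s (2 * Real.pi * I * n * z) =
      (ε * I) ^ s * ((1 / (2 * Real.pi * (ε * n) : ℝ)) ^ s * Gamma s) := by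
  have hs0 : s ≠ 0 := by rintro rfl; simp at hs
  obtain ⟨c, hc⟩ := exists_hurwitzFourier_add_eq n hs
  have hε2 : ε * ε = 1 := by rw [← abs_mul_abs_self, hε, one_mul]
  have hε0 : (ε * I : ℂ) ≠ 0 := by
    simp; rintro rfl; simp at hε
  have hεs : (ε * I : ℂ) ^ s ≠ 0 := by simp [cpow_eq_zero_iff, hε0]
  set b : ℝ := 2 * Real.pi * (ε * n) with hbdef
  have hb : 0 < b := by positivity
  rw [hc z hz]
  -- The constant `c` is found on the ray `z = yεi`: `T` is a primitive of `y ^ (s - 1) * exp (-b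
  -- y)` with `T 0 = 0` and limit `(εi) ^ (-s) * c` at infinity, so that limit is Euler's integral.
  set T : ℝ → ℂ := fun y => (y : ℂ) ^ s * lowerGammaSeries s (-b * y) with hT
  have hS : ∀ y : ℝ, 0 < y → T y = (ε * I : ℂ) ^ (-s) *
      (c - hurwitzFourier n s (y * (ε * I))) := by
    intro y hy
    have hmem : (y : ℂ) * (ε * I) ∈ slitPlane := by
      refine Or.inr ?_
      simp only [mul_im, ofReal_re, ofReal_im, I_re, I_im, mul_re]
      simp; exact ⟨hy.ne', by rintro rfl; simp at hε⟩
    have h1 : 2 * Real.pi * I * n * (y * (ε * I)) = -b * y := by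
      rw [hbdef]; push_cast; linear_combination (2 * Real.pi * n * y * ε : ℂ) * I_mul_I
    have h2 : ((y : ℂ) * (ε * I)) ^ s = (y : ℂ) ^ s * (ε * I) ^ s := by
      have hy0 : (y : ℂ) ≠ 0 := by exact_mod_cast hy.ne'
      rw [cpow_def_of_ne_zero (mul_ne_zero hy0 hε0), cpow_def_of_ne_zero hy0,
        cpow_def_of_ne_zero hε0, log_ofReal_mul hy hε0, add_mul, exp_add, ofReal_log hy.le]
    rw [← hc _ hmem, add_sub_cancel_left, h1, h2, cpow_neg]
    simp only [hT]
    field_simp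
  have hlim : Tendsto T atTop (𝓝 ((ε * I : ℂ) ^ (-s) * c)) := by
    have := ((tendsto_hurwitzFourier_nhds_zero hs0 hε hn).const_sub c).const_mul
      ((ε * I : ℂ) ^ (-s))
    rw [sub_zero] at this
    exact this.congr' ((eventually_gt_atTop 0).mono fun y hy => (hS y hy).symm)
  have hderiv : ∀ y ∈ Ioi (0 : ℝ), HasDerivAt T ((y : ℂ) ^ (s - 1) * exp (-(b * y))) y := by
    intro y hy
    have := (hasDerivAt_cpow_mul_lowerGammaSeries hs (-b) (z := (y : ℂ))
      (ofReal_mem_slitPlane.2 hy)).comp_ofReal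
    refine this.congr_deriv ?_
    rw [mul_comm, neg_mul]
  have hcont : ContinuousWithinAt T (Ici 0) 0 := by
    refine ContinuousAt.continuousWithinAt (ContinuousAt.mul
      (continuousAt_ofReal_cpow_const 0 s (Or.inl hs)) ?_)
    exact ((differentiable_lowerGammaSeries hs).continuous.comp (by fun_prop)).continuousAt
  have hint := integral_cpow_mul_exp_neg_mul_Ioi hs hb
  have hne : (1 / (b : ℂ)) ^ s * Gamma s ≠ 0 := by
    refine mul_ne_zero ?_ (Gamma_ne_zero_of_re_pos hs)
    have : (b : ℂ) ≠ 0 := by exact_mod_cast hb.ne'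
    simp [cpow_eq_zero_iff, this]
  -- The integral of a non-integrable function is 0 by convention, whereas this one has a nonzero
  -- value.
  have hintegrable : IntegrableOn (fun y : ℝ => (y : ℂ) ^ (s - 1) * exp (-(b * y))) (Ioi 0) :=
    not_imp_comm.1 integral_undef (hint ▸ hne)
  have hfin := integral_Ioi_of_hasDerivAt_of_tendsto hcont hderiv hintegrable hlim
  rw [hint] at hfin
  have hT0 : T 0 = 0 := by simp [hT, zero_cpow hs0]
  rw [hT0, sub_zero, cpow_neg] at hfin
  rw [hfin]
  field_simp

theorem expIntegral_one_sub {s : ℂ} (hs : 0 < s.re) (w : ℂ) :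
    expIntegral (1 - s) w = w ^ (-s) * Gamma s - lowerGammaSeries s (-w) := by
  rw [expIntegral, if_neg]
  · rw [lowerGammaSeries, sub_sub_cancel, sub_sub_cancel_left]
  · rintro ⟨n, hn⟩
    have h := congrArg re hn
    simp at h
    linarith [n.cast_nonneg (α := ℝ)]

/-- The exponential integral is a Fourier integral of the Hurwitz zeta function along the segment
from `ia` to `ia + 1`. -/
theorem hurwitzFourier_eq_expIntegral {n : ℤ} (hn : n ≠ 0) {s : ℂ} (hs : 0 < s.re) {a : ℝ}
    (ha : 0 < a) :
    hurwitzFourier n s (a * I) = (a * I : ℂ) ^ s * expIntegral (1 - s) (2 * Real.pi * n * a) := by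
  have hz : (a * I : ℂ) ∈ slitPlane := Or.inr (by simpa using ha.ne')
  -- The two logarithm hypotheses carry the branch convention. For `n < 0`, `arg (2πna) = π` and
  -- `log (-i) = log i - πi`, so the factor `e^{-πis}` appears on both sides.
  have key : ∀ ε : ℝ, |ε| = 1 → 0 < ε * n → log (2 * Real.pi * n * a) =
      Real.log (2 * Real.pi * (ε * n)) + Real.log a + log ε → log (ε * I) = log I - log ε →
      hurwitzFourier n s (a * I) =
        (a * I : ℂ) ^ s * expIntegral (1 - s) (2 * Real.pi * n * a) := by
    intro ε hε hεn hlog hlog'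
    have h := hurwitzFourier_add_eq hs hε hεn hz
    have hb : 0 < 2 * Real.pi * (ε * n) := by positivity
    have hε0 : (ε : ℂ) ≠ 0 := by
      norm_cast; rintro rfl; simp at hε
    have hw : 2 * (Real.pi : ℂ) * n * a ≠ 0 := by
      have := Real.pi_ne_zero
      have := ha.ne'
      simp_all
    have h1 : (ε * I : ℂ) ^ s * (1 / (2 * Real.pi * (ε * n) : ℝ) : ℂ) ^ s =
        (a * I : ℂ) ^ s * (2 * Real.pi * n * a : ℂ) ^ (-s) := by
      have hb' : ((2 * Real.pi * (ε * n) : ℝ) : ℂ) ≠ 0 := by exact_mod_cast hb.ne'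
      rw [cpow_def_of_ne_zero (mul_ne_zero hε0 I_ne_zero), cpow_def_of_ne_zero hw,
        cpow_def_of_ne_zero (slitPlane_ne_zero hz), cpow_def_of_ne_zero (one_div_ne_zero hb'),
        ← exp_add, ← exp_add, hlog, hlog', log_ofReal_mul ha I_ne_zero]
      have : log (1 / ((2 * Real.pi * (ε * n) : ℝ) : ℂ)) = -Real.log (2 * Real.pi * (ε * n)) := by
        rw [← ofReal_one, ← ofReal_div, ← ofReal_log (by positivity), one_div, Real.log_inv]
        simp
      rw [this]
      congr 1
      ring
    rw [← mul_assoc ((ε * I : ℂ) ^ s), h1] at h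
    rw [expIntegral_one_sub hs, show -(2 * Real.pi * n * a : ℂ) = 2 * Real.pi * I * n * (a * I) by
      linear_combination -(2 * Real.pi * n * a : ℂ) * I_mul_I]
    linear_combination h
  rcases lt_or_gt_of_ne hn with h | h
  · have h' : 0 < 2 * Real.pi * (-1 * (n : ℝ)) := by
      have : (n : ℝ) < 0 := by exact_mod_cast h
      have := Real.pi_pos
      apply mul_pos <;> linarith
    refine key (-1) (by simp) (by simpa using h) ?_ ?_
    · rw [← ofReal_add, ← Real.log_mul h'.ne' ha.ne', ← log_ofReal_mul (by positivity) (by simp)]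
      congr 1
      push_cast
      ring
    · simp [log_neg_I, log_I, log_neg_one]
      ring
  · have h0 : (0 : ℝ) < n := by exact_mod_cast h
    refine key 1 (by simp) (by simpa using h) ?_ (by simp)
    rw [← ofReal_add, ← Real.log_mul (by positivity) ha.ne',
      ← log_ofReal_mul (by positivity) (by simp)]
    congr 1
    push_cast
    ring

/-! ### Fourier expansions -/

theorem IsWeaklyHolomorphicCuspForm.apply_one_vadd {N : ℕ} {k : ℤ} {f : ℍ → ℂ}
    (hf : IsWeaklyHolomorphicCuspForm N k f) (z : ℍ) : f ((1 : ℝ) +ᵥ z) = f z := by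
  have hT : ModularGroup.T ∈ CongruenceSubgroup.Gamma0 N := by
    rw [CongruenceSubgroup.Gamma0_mem]
    simp [ModularGroup.T]
  have hd : UpperHalfPlane.denom (ModularGroup.T : GL (Fin 2) ℝ) z = 1 := by
    rw [ModularGroup.denom_apply]
    simp [ModularGroup.T]
  have h := congrFun (hf.slash_eq ModularGroup.T hT) z
  rwa [ModularForm.SL_slash_apply, UpperHalfPlane.modular_T_smul, hd, one_zpow, mul_one] at h

theorem IsWeaklyHolomorphicCuspForm.apply_natCast_vadd {N : ℕ} {k : ℤ} {f : ℍ → ℂ}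
    (hf : IsWeaklyHolomorphicCuspForm N k f) (r : ℕ) (z : ℍ) : f ((r : ℝ) +ᵥ z) = f z := by
  induction r with
  | zero => simp
  | succ r ih =>
    rw [Nat.cast_succ, add_comm, add_vadd, hf.apply_one_vadd, ih]

theorem sum_range_exp_eq_ite {N : ℕ} (hN : 0 < N) (n : ℤ) :
    ∑ r ∈ Finset.range N, exp (2 * Real.pi * I * n * r / N) = if (N : ℤ) ∣ n then (N : ℂ) else 0 := by
  have hN0 : (N : ℂ) ≠ 0 := by exact_mod_cast hN.ne'
  have hpow : ∀ r : ℕ, exp (2 * Real.pi * I * n * r / N) = exp (2 * Real.pi * I * n / N) ^ r := by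
    intro r
    rw [← exp_nat_mul]
    congr 1
    ring
  simp only [hpow]
  split_ifs with h
  · obtain ⟨m, rfl⟩ := h
    have : exp (2 * Real.pi * I * ((N * m : ℤ) : ℂ) / N) = 1 := by
      rw [exp_eq_one_iff]
      refine ⟨m, ?_⟩
      push_cast
      field_simp
    simp only [this]
    simp
  · have h1 : exp (2 * Real.pi * I * n / N) ≠ 1 := by
      intro h1
      obtain ⟨m, hm⟩ := exp_eq_one_iff.1 h1
      refine h ⟨m, ?_⟩
      have h2 : (n : ℂ) = N * m := by
        have h3 : 2 * Real.pi * I * n = (N * m) * (2 * Real.pi * I) := by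
          rw [div_eq_iff hN0] at hm
          linear_combination hm
        refine mul_left_cancel₀ two_pi_I_ne_zero ?_
        linear_combination h3
      exact_mod_cast h2
    have h2 := mul_geom_sum (exp (2 * Real.pi * I * n / N)) N
    have h3 : exp (2 * Real.pi * I * n / N) ^ N = 1 := by
      rw [← hpow, mul_div_cancel_right₀ _ hN0, mul_comm, exp_int_mul_two_pi_mul_I]
    rw [h3, sub_self] at h2
    exact (mul_eq_zero.1 h2).resolve_left (sub_ne_zero.2 h1)

/-- The expansion of `f` in powers of `e^{2πiz}`. -/
theorem IsWeaklyHolomorphicCuspForm.exists_hasSum {N : ℕ} (hN : 0 < N) {k : ℤ} {f : ℍ → ℂ}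
    (hf : IsWeaklyHolomorphicCuspForm N k f) :
    ∃ b : ℤ → ℂ, b 0 = 0 ∧
      ∀ z : ℍ, HasSum (fun n : ℤ => b n * exp (2 * Real.pi * I * n * z)) (f z) := by
  obtain ⟨n₀, a, -, ha0, ha⟩ := hf.expansion 1
  rw [SlashAction.slash_one] at ha
  have hN0 : (N : ℂ) ≠ 0 := by exact_mod_cast hN.ne'
  refine ⟨fun n => a (N * n), by simpa using ha0, fun z => ?_⟩
  -- Averaging over the translates `z + r` for `r < N` fixes `f` and, by orthogonality of the roots
  -- of unity, kills every exponent not divisible by `N`.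
  have h1 := (hasSum_sum fun r (_ : r ∈ Finset.range N) => ha ((r : ℝ) +ᵥ z)).div_const (N : ℂ)
  simp only [hf.apply_natCast_vadd, Finset.sum_const, Finset.card_range, nsmul_eq_mul,
    mul_div_cancel_left₀ _ hN0] at h1
  have hterm : ∀ n : ℤ, (∑ r ∈ Finset.range N, a n * exp (2 * Real.pi * I * n *
      (((r : ℝ) +ᵥ z : ℍ) : ℂ) / N)) / N =
      if (N : ℤ) ∣ n then a n * exp (2 * Real.pi * I * n * z / N) else 0 := by
    intro n
    have : ∀ r : ℕ, a n * exp (2 * Real.pi * I * n * (((r : ℝ) +ᵥ z : ℍ) : ℂ) / N) =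
        a n * exp (2 * Real.pi * I * n * z / N) * exp (2 * Real.pi * I * n * r / N) := by
      intro r
      rw [mul_assoc (a n), ← exp_add, UpperHalfPlane.coe_vadd]
      congr 2
      push_cast
      ring
    simp only [this]
    rw [← Finset.mul_sum, sum_range_exp_eq_ite hN]
    split_ifs
    · exact mul_div_cancel_right₀ _ hN0
    · simp
  simp only [hterm] at h1
  have hinj : Function.Injective fun n : ℤ => (N : ℤ) * n :=
    mul_right_injective₀ (by exact_mod_cast hN.ne')
  refine ((hinj.hasSum_iff fun n hn => if_neg ?_).2 h1).congr_fun fun n => ?_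
  · rintro ⟨m, rfl⟩
    exact hn ⟨m, rfl⟩
  · simp only [Function.comp_apply, dvd_mul_right, if_true]
    congr 2
    push_cast
    field_simp

theorem hasSum_integral_fourier {b : ℤ → ℂ} {F g : ℝ → ℂ} {y : ℝ}
    (hF : ∀ x ∈ Icc (0 : ℝ) 1,
      HasSum (fun n : ℤ => b n * exp (2 * Real.pi * I * n * (y * I + x))) (F x))
    (hg : ContinuousOn g (Icc 0 1)) :
    HasSum (fun n : ℤ => ∫ x in (0 : ℝ)..1,
      b n * exp (2 * Real.pi * I * n * (y * I + x)) * g x) (∫ x in (0 : ℝ)..1, F x * g x) := by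
  obtain ⟨C, hC⟩ := isCompact_Icc.exists_bound_of_continuousOn hg
  -- The modulus of `e^{2πin(yi + x)}` does not depend on `x`, so the series at `x = 0` majorises
  -- all the others.
  have hs := (hF 0 (left_mem_Icc.2 zero_le_one)).summable.norm
  have hsub : uIoc (0 : ℝ) 1 ⊆ Icc 0 1 := by
    rw [uIoc_of_le zero_le_one]; exact Ioc_subset_Icc_self
  refine intervalIntegral.hasSum_integral_of_dominated_convergence
    (fun n _ => ‖b n * exp (2 * Real.pi * I * n * (y * I + (0 : ℝ)))‖ * C)
    (fun n => ?_) (fun n => ?_) ?_ ?_ ?_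
  · exact (ContinuousOn.intervalIntegrable_of_Icc zero_le_one
      (ContinuousOn.mul (by fun_prop) hg)).def'.aestronglyMeasurable
  · refine Eventually.of_forall fun x hx => ?_
    rw [norm_mul]
    refine mul_le_mul (le_of_eq ?_) (hC x (hsub hx)) (norm_nonneg _) (norm_nonneg _)
    rw [norm_mul, norm_mul, norm_exp, norm_exp]
    simp
  · exact Eventually.of_forall fun _ _ => hs.mul_right C
  · exact intervalIntegrable_const
  · exact Eventually.of_forall fun x hx => (hF x (hsub hx)).mul_right _

theorem integral_exp_two_pi_mul_I (n : ℤ) :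
    ∫ x in (0 : ℝ)..1, exp (2 * Real.pi * I * n * x) = if n = 0 then 1 else 0 := by
  split_ifs with h
  · simp [h]
  · have hc : 2 * Real.pi * I * n ≠ 0 := mul_ne_zero two_pi_I_ne_zero (by exact_mod_cast h)
    rw [integral_exp_mul_complex hc, ofReal_one, mul_one, mul_comm _ (n : ℂ),
      exp_int_mul_two_pi_mul_I]
    simp

theorem coe_ofComplex_mul_I_add {y : ℝ} (hy : 0 < y) (x : ℝ) :
    ((UpperHalfPlane.ofComplex (y * I + x) : ℍ) : ℂ) = y * I + x := by
  rw [UpperHalfPlane.ofComplex_apply_of_im_pos (by simpa using hy)]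

theorem coeff_eq_of_hasSum {f : ℍ → ℂ} {b : ℤ → ℂ}
    (h : ∀ z : ℍ, HasSum (fun n : ℤ => b n * exp (2 * Real.pi * I * n * z)) (f z)) (n : ℤ) :
    coeff f n = b n := by
  have h1 := hasSum_integral_fourier (b := b) (y := 1)
    (F := fun x => f (UpperHalfPlane.ofComplex ((1 : ℝ) * I + x)))
    (g := fun x => exp (-(2 * Real.pi * I * n * (x + I))))
    (fun x _ => by
      have := h (UpperHalfPlane.ofComplex ((1 : ℝ) * I + x))
      rwa [coe_ofComplex_mul_I_add one_pos] at this) (by fun_prop)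
  have h2 : ∀ m : ℤ, ∫ x in (0 : ℝ)..1, b m * exp (2 * Real.pi * I * m * ((1 : ℝ) * I + x)) *
      exp (-(2 * Real.pi * I * n * (x + I))) = if m = n then b n else 0 := by
    intro m
    have : ∀ x : ℝ, b m * exp (2 * Real.pi * I * m * ((1 : ℝ) * I + x)) *
        exp (-(2 * Real.pi * I * n * (x + I))) =
        b m * exp (2 * Real.pi * I * (m - n) * I) *
          exp (2 * Real.pi * I * ((m - n : ℤ) : ℂ) * x) := by
      intro x
      rw [mul_assoc (b m), mul_assoc (b m), ← exp_add, ← exp_add]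
      congr 2
      push_cast
      ring
    simp only [this]
    rw [intervalIntegral.integral_const_mul, integral_exp_two_pi_mul_I]
    simp only [sub_eq_zero]
    split_ifs with hmn
    · simp [hmn]
    · simp
  simp only [h2] at h1
  have h3 := h1.unique (hasSum_ite_eq n (b n))
  rw [← h3, coeff]
  refine intervalIntegral.integral_congr fun x _ => ?_
  simp only [ofReal_one, one_mul, add_comm]

/-! ### The function `Λ(f, s)` as an integral over the segment -/

theorem I_div_sqrt_eq (N : ℕ) : I / (Real.sqrt N : ℂ) = ((1 / Real.sqrt N : ℝ) : ℂ) * I := by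
  push_cast; ring

theorem hasSum_lambdaTerm {N : ℕ} (hN : 0 < N) {k : ℤ} {f : ℍ → ℂ}
    (hf : IsWeaklyHolomorphicCuspForm N k f) {s : ℂ} (hs : 0 < s.re) :
    HasSum (fun n : {n : ℤ // n ≠ 0} => lambdaTerm N f s n)
      ((I / Real.sqrt N) ^ (-s) * ∫ x in (0 : ℝ)..1,
        f (UpperHalfPlane.ofComplex (I / Real.sqrt N + x)) *
          hurwitz (1 - s) (I / Real.sqrt N + x)) := by
  obtain ⟨b, hb0, hb⟩ := hf.exists_hasSum hN
  have hcoeff := coeff_eq_of_hasSum hb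
  set a : ℝ := 1 / Real.sqrt N with ha_def
  have ha : 0 < a := one_div_pos.2 (Real.sqrt_pos.2 (by exact_mod_cast hN))
  have hz : (a * I : ℂ) ∈ slitPlane := Or.inr (by simpa using ha.ne')
  have hs1 : 1 - s ≠ 1 := by
    rintro h; rw [sub_eq_self] at h; simp [h] at hs
  rw [I_div_sqrt_eq, ← ha_def]
  have hsum := (hasSum_integral_fourier (b := b) (y := a)
    (F := fun x => f (UpperHalfPlane.ofComplex (a * I + x)))
    (g := fun x => hurwitz (1 - s) (a * I + x))
    (fun x _ => by
      have := hb (UpperHalfPlane.ofComplex (a * I + x))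
      rwa [coe_ofComplex_mul_I_add ha] at this)
    ((differentiableOn_hurwitz_right hs1).continuousOn.comp (by fun_prop)
      fun x hx => add_ofReal_mem_slitPlane hz hx.1)).mul_left ((a * I : ℂ) ^ (-s))
  refine ((hasSum_subtype_iff_of_support_subset (s := {n : ℤ | n ≠ 0}) fun n hn => ?_).2
    hsum).congr_fun fun n => ?_
  -- The term `n = 0`, to which the exponential integral formula does not apply, drops out because
  -- `b 0 = 0`.
  · rintro rfl
    simp [hb0] at hn
  · have h := hurwitzFourier_eq_expIntegral n.2 hs ha
    have hne : (a * I : ℂ) ^ s ≠ 0 := by simp [cpow_eq_zero_iff, ha.ne']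
    have hw : 2 * Real.pi * ((n : ℤ) : ℂ) / (Real.sqrt N : ℂ) = 2 * Real.pi * (n : ℤ) * a := by
      rw [ha_def]; push_cast; ring
    simp only [Function.comp_apply, mul_assoc (b n)]
    rw [intervalIntegral.integral_const_mul, ← hurwitzFourier, h, lambdaTerm, hcoeff, hw, cpow_neg]
    field_simp

theorem continuousOn_prod_segment {N : ℕ} (hN : 0 < N) {k : ℤ} {f : ℍ → ℂ}
    (hf : IsWeaklyHolomorphicCuspForm N k f) :
    ContinuousOn (Function.uncurry fun (s : ℂ) (x : ℝ) =>
      f (UpperHalfPlane.ofComplex (I / Real.sqrt N + x)) * hurwitz (1 - s) (I / Real.sqrt N + x))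
      ({s : ℂ | 0 < s.re} ×ˢ Icc 0 1) := by
  have hpos : 0 < 1 / Real.sqrt N := one_div_pos.2 (Real.sqrt_pos.2 (by exact_mod_cast hN))
  have hmem : ∀ x : ℝ, 0 < (I / Real.sqrt N + x).im := fun x => by
    rw [I_div_sqrt_eq, add_im, im_ofReal_mul, I_im, mul_one, ofReal_im, add_zero]
    exact hpos
  have hf' := (UpperHalfPlane.mdifferentiable_iff.1 hf.holo).continuousOn
  refine ContinuousOn.mul (hf'.comp (f := fun q : ℂ × ℝ => I / (Real.sqrt N : ℂ) + (q.2 : ℂ))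
    (by fun_prop) fun q _ => hmem q.2) ?_
  refine continuousOn_hurwitz.comp
    (f := fun q : ℂ × ℝ => (1 - q.1, I / (Real.sqrt N : ℂ) + (q.2 : ℂ))) (by fun_prop)
    fun q hq => ⟨?_, Or.inr (hmem q.2).ne'⟩
  rintro h
  have h0 : q.1 = 0 := by simpa using h
  have h1 : 0 < q.1.re := hq.1
  simp [h0] at h1

theorem differentiableOn_segment {N : ℕ} (hN : 0 < N) (f : ℍ → ℂ) (x : ℝ) :
    DifferentiableOn ℂ (fun s => f (UpperHalfPlane.ofComplex (I / Real.sqrt N + x)) *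
      hurwitz (1 - s) (I / Real.sqrt N + x)) {s : ℂ | 0 < s.re} := by
  refine DifferentiableOn.const_mul ((differentiableOn_hurwitz_left (Or.inr ?_)).comp
    (f := fun s : ℂ => 1 - s) (by fun_prop) fun s hs h => ?_) _
  · rw [I_div_sqrt_eq]
    simpa using hN.ne'
  · have h0 : s = 0 := by simpa using h
    have h1 : 0 < s.re := hs
    simp [h0] at h1

theorem iteratedDeriv_segment (N k : ℕ) (f : ℍ → ℂ) (r : ℕ) (x : ℝ) :
    iteratedDeriv r (fun s => f (UpperHalfPlane.ofComplex (I / Real.sqrt N + x)) *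
      hurwitz (1 - s) (I / Real.sqrt N + x)) ((k : ℂ) / 2) =
      (-1) ^ r * segmentIntegrand N k f r x := by
  rw [iteratedDeriv_const_mul_field, iteratedDeriv_comp_const_sub
    (f := fun t => hurwitz t (I / Real.sqrt N + x))]
  simp only [segmentIntegrand, hurwitzDeriv, smul_eq_mul]
  ring

theorem cpow_neg_I_div_sqrt {N : ℕ} (hN : 0 < N) (k m : ℕ) :
    (-1 : ℂ) ^ m * (I / Real.sqrt N) ^ (-((k : ℂ) / 2)) =
      I ^ (2 * (m : ℂ) - (k : ℂ) / 2) * (N : ℂ) ^ ((k : ℂ) / 4) := by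
  have hN' : (0 : ℝ) < N := by exact_mod_cast hN
  have hpos : 0 < 1 / Real.sqrt N := one_div_pos.2 (Real.sqrt_pos.2 hN')
  have h1 : I ^ (2 * (m : ℂ)) = (-1) ^ m := by
    rw [show (2 * (m : ℂ)) = ((2 * m : ℕ) : ℂ) by push_cast; ring, cpow_natCast, pow_mul, I_sq]
  have hlog : Real.log (1 / Real.sqrt N) = -(Real.log N / 2) := by
    rw [one_div, Real.log_inv, Real.log_sqrt hN'.le]
  have h0 : ((1 / Real.sqrt N : ℝ) : ℂ) * I ≠ 0 :=
    mul_ne_zero (by exact_mod_cast hpos.ne') I_ne_zero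
  rw [I_div_sqrt_eq, sub_eq_add_neg, cpow_add _ _ I_ne_zero, h1, mul_assoc,
    cpow_def_of_ne_zero h0, cpow_def_of_ne_zero I_ne_zero,
    cpow_def_of_ne_zero (by exact_mod_cast hN.ne' : (N : ℂ) ≠ 0), ← exp_add,
    log_ofReal_mul hpos I_ne_zero, hlog, ← natCast_log]
  congr 2
  push_cast
  ring

end WeaklyHolomorphic

/-! ### The formula for the derivatives -/

open WeaklyHolomorphic in
theorem theorem1p1 (N k m : ℕ) (hN : 0 < N) (hk : Even k) (hk0 : 0 < k) (hm : 0 < m)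
    (f : ℍ → ℂ) (hf : WeaklyHolomorphic.IsWeaklyHolomorphicCuspForm N k f)
    (hW : f ∣[(k : ℤ)] (WeaklyHolomorphic.frickeMatrix N hN : GL (Fin 2) ℝ) = f) :
    (∀ s : ℂ, 0 < s.re → Summable
      (fun n : {n : ℤ // n ≠ 0} => WeaklyHolomorphic.lambdaTerm N f s n)) ∧
    DifferentiableOn ℂ (WeaklyHolomorphic.Lambda N f) {s : ℂ | 0 < s.re} ∧
    (∀ r : ℕ, IntervalIntegrable (WeaklyHolomorphic.segmentIntegrand N k f r)
      MeasureTheory.volume 0 1) ∧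
    iteratedDeriv m (WeaklyHolomorphic.Lambda N f) ((k : ℂ) / 2) =
      Complex.I ^ (2 * (m : ℂ) - (k : ℂ) / 2) * (N : ℂ) ^ ((k : ℂ) / 4) *
        ∑ j ∈ Finset.range (m + 1),
          (m.choose j : ℂ) * Complex.log (Complex.I / Real.sqrt N) ^ j *
            ∫ x in (0 : ℝ)..1, WeaklyHolomorphic.segmentIntegrand N k f (m - j) x := by
  set F : ℂ → ℝ → ℂ := fun s x =>
    f (UpperHalfPlane.ofComplex (Complex.I / Real.sqrt N + x)) *
      hurwitz (1 - s) (Complex.I / Real.sqrt N + x) with hF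
  set G : ℂ → ℂ := fun s => ∫ x in (0 : ℝ)..1, F s x with hG
  set U : Set ℂ := {s : ℂ | 0 < s.re} with hUdef
  have hU : IsOpen U := isOpen_setOf_lt_re 0
  have hFc : ContinuousOn (Function.uncurry F) (U ×ˢ Icc 0 1) := continuousOn_prod_segment hN hf
  have hFd : ∀ x ∈ Icc (0 : ℝ) 1, DifferentiableOn ℂ (fun s => F s x) U := fun x _ =>
    differentiableOn_segment hN f x
  have hGd : DifferentiableOn ℂ G U :=
    differentiableOn_intervalIntegral_of_continuousOn_prod hU hFc hFd
  have hz0 : Complex.I / (Real.sqrt N : ℂ) ≠ 0 := div_ne_zero Complex.I_ne_zero (by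
    exact_mod_cast (Real.sqrt_pos.2 (by exact_mod_cast hN : (0 : ℝ) < N)).ne')
  have hpow : ∀ s : ℂ, (Complex.I / Real.sqrt N) ^ (-s) =
      Complex.exp (-Complex.log (Complex.I / Real.sqrt N) * s) := fun s => by
    rw [Complex.cpow_def_of_ne_zero hz0, mul_neg, neg_mul]
  have hLambda : ∀ s ∈ U, Lambda N f s =
      Complex.exp (-Complex.log (Complex.I / Real.sqrt N) * s) * G s := fun s hs => by
    rw [← hpow]
    exact (hasSum_lambdaTerm hN hf hs).tsum_eq
  have hk' : (k : ℂ) / 2 ∈ U := by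
    have : (0 : ℝ) < k := by exact_mod_cast hk0
    simpa [hUdef] using this
  have hderiv : ∀ r : ℕ, (fun x : ℝ => iteratedDeriv r (fun t => F t x) ((k : ℂ) / 2)) =
      fun x => (-1) ^ r * segmentIntegrand N k f r x := fun r =>
    funext fun x => iteratedDeriv_segment N k f r x
  have hGr : ∀ r : ℕ, iteratedDeriv r G ((k : ℂ) / 2) =
      (-1) ^ r * ∫ x in (0 : ℝ)..1, segmentIntegrand N k f r x := fun r => by
    rw [(iteratedDeriv_continuousOn_prod hU hFc hFd r).2.2 _ hk', hderiv,
      intervalIntegral.integral_const_mul]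
  refine ⟨fun s hs => (hasSum_lambdaTerm hN hf hs).summable, ?_, fun r => ?_, ?_⟩
  · exact DifferentiableOn.congr (DifferentiableOn.mul (by fun_prop) hGd) hLambda
  · have h := intervalIntegrable_of_continuousOn_prod
      (iteratedDeriv_continuousOn_prod hU hFc hFd r).1 hk'
    rw [hderiv] at h
    -- A second factor `(-1) ^ r` cancels the one that comes from differentiating `ζ(1 - s, z)` in
    -- `s`.
    have h2 := h.const_mul ((-1 : ℂ) ^ r)
    simpa [← mul_assoc, ← mul_pow] using h2
  · have hEq : Lambda N f =ᶠ[𝓝 ((k : ℂ) / 2)] fun s =>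
        Complex.exp (-Complex.log (Complex.I / Real.sqrt N) * s) * G s :=
      eventually_of_mem (hU.mem_nhds hk') hLambda
    rw [hEq.iteratedDeriv_eq, iteratedDeriv_fun_mul (by fun_prop)
      (hGd.analyticAt (hU.mem_nhds hk')).contDiffAt, ← cpow_neg_I_div_sqrt hN, Finset.mul_sum]
    refine Finset.sum_congr rfl fun j hj => ?_
    have hjm : j ≤ m := Nat.lt_succ_iff.1 (Finset.mem_range.1 hj)
    -- `(-1) ^ j` comes from the powers of `-log (i/√N)`, `(-1) ^ (m - j)` from the chain rule
    -- through `1 - s`; together they give `i ^ (2m)`.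
    have hsign : (-1 : ℂ) ^ m = (-1) ^ j * (-1) ^ (m - j) := by
      rw [← pow_add, Nat.add_sub_cancel' hjm]
    rw [iteratedDeriv_cexp_const_mul, hGr, hsign, hpow, neg_pow]
    ring
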